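/- Unit squares are closed axis-parallel squares of side length $1$ in the plane. An instance of Unique Square Set Cover consists of a finite set $P$ of $n$ points in $\mathbb{R}^2$ and a finite set $D$ of $m$ unit squares. A feasible solution is a subset $S\subseteq D$ such that every point of $P$ lies in at least one square of $S$. An optimal solution is a feasible solution that maximizes the number of points of $P$ lying in exactly one square of $S$. The model of computation is the real RAM: natural-number and real variables and arrays; unit-cost addition, subtraction and comparison of natural numbers; unit-cost arithmetic and comparison of real numbers; no rounding of reals to integers. The input consists of $n$, $m$, the coordinates of the points and the coordinates of the lower-left corners of the squares. Theorem. There is an absolute constant $C$ such that for every real $k\ge 1$ there are an algorithm and a constant $A_k$ with the following property. On every instance in which all points of $P$ lie in some axis-parallel $k\times k$ square, the algorithm halts after at most $A_k\cdot \max(n,1)\cdot \max(m,1)^{Ck^2}$ steps; it outputs an optimal solution if a feasible solution exists, and otherwise reports that there is none. In particular, for constant $k$ an optimal solution is computed in $O(n\cdot m^{O(k^2)})$ time. -/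

import Mathlib

namespace UniqueSquareCover

/-! ### The problem -/

/-- The closed axis-parallel unit square with lower-left corner `c`
(`ℝ × ℝ` carries the coordinatewise order). -/
def unitSquare (c : ℝ × ℝ) : Set (ℝ × ℝ) :=
  Set.Icc c (c + (1, 1))

/-- `S` is a sub-collection of `D` that covers every point of `P`. Collections of unit squares are
given by the sets of their lower-left corners. -/
def IsCover (P D S : Finset (ℝ × ℝ)) : Prop :=
  S ⊆ D ∧ ∀ q ∈ P, ∃ c ∈ S, q ∈ unitSquare c

open Classical in
/-- The number of points of `P` that lie in exactly one square of `S`. -/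
noncomputable def uniqueCount (P S : Finset (ℝ × ℝ)) : ℕ :=
  (P.filter fun q => ∃! c, c ∈ S ∧ q ∈ unitSquare c).card

/-- `S` is an optimal solution of the instance `(P, D)`. -/
def IsOptimal (P D S : Finset (ℝ × ℝ)) : Prop :=
  IsCover P D S ∧ ∀ S', IsCover P D S' → uniqueCount P S' ≤ uniqueCount P S

/-! ### The machine model: a real RAM, programmed by while-programs

The memory has natural-number and real variables and arrays, whose names are natural numbers; a
program mentions only finitely many names, while array indices are computed at run time. Natural
numbers can be added, subtracted (truncated at `0`) and compared, but not multiplied; real numbers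
admit the four arithmetic operations and comparisons. There is no rounding and no other way to turn
a real into a natural number. Every operation, memory access, constant and test has unit cost. -/

structure State where
  natVar : ℕ → ℕ
  natArr : ℕ → ℕ → ℕ
  realVar : ℕ → ℝ
  realArr : ℕ → ℕ → ℝ

inductive NatExpr where
  | const (c : ℕ)
  | var (x : ℕ)
  | get (a : ℕ) (i : NatExpr)
  | add (e f : NatExpr)
  | sub (e f : NatExpr)

inductive RealExpr where
  | const (c : ℤ)
  | var (x : ℕ)
  | get (a : ℕ) (i : NatExpr)
  | add (e f : RealExpr)
  | sub (e f : RealExpr)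
  | mul (e f : RealExpr)
  | div (e f : RealExpr)

inductive BoolExpr where
  | natLe (e f : NatExpr)
  | realLe (e f : RealExpr)
  | not (b : BoolExpr)
  | and (b c : BoolExpr)

namespace NatExpr

def eval (σ : State) : NatExpr → ℕ
  | const c => c
  | var x => σ.natVar x
  | get a i => σ.natArr a (eval σ i)
  | add e f => eval σ e + eval σ f
  | sub e f => eval σ e - eval σ f

def cost : NatExpr → ℕ
  | const _ => 1
  | var _ => 1
  | get _ i => 1 + cost i
  | add e f => 1 + cost e + cost f
  | sub e f => 1 + cost e + cost f

end NatExpr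

namespace RealExpr

noncomputable def eval (σ : State) : RealExpr → ℝ
  | const c => c
  | var x => σ.realVar x
  | get a i => σ.realArr a (i.eval σ)
  | add e f => eval σ e + eval σ f
  | sub e f => eval σ e - eval σ f
  | mul e f => eval σ e * eval σ f
  | div e f => eval σ e / eval σ f

def cost : RealExpr → ℕ
  | const _ => 1
  | var _ => 1
  | get _ i => 1 + i.cost
  | add e f => 1 + cost e + cost f
  | sub e f => 1 + cost e + cost f
  | mul e f => 1 + cost e + cost f
  | div e f => 1 + cost e + cost f

end RealExpr

namespace BoolExpr

/-- `b.Holds σ`: the test `b` succeeds in the state `σ`. -/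
def Holds (σ : State) : BoolExpr → Prop
  | natLe e f => e.eval σ ≤ f.eval σ
  | realLe e f => e.eval σ ≤ f.eval σ
  | not b => ¬ Holds σ b
  | and b c => Holds σ b ∧ Holds σ c

def cost : BoolExpr → ℕ
  | natLe e f => 1 + e.cost + f.cost
  | realLe e f => 1 + e.cost + f.cost
  | not b => 1 + cost b
  | and b c => 1 + cost b + cost c

end BoolExpr

inductive Program where
  | skip
  | setNat (x : ℕ) (e : NatExpr)
  | putNat (a : ℕ) (i e : NatExpr)
  | setReal (x : ℕ) (e : RealExpr)
  | putReal (a : ℕ) (i : NatExpr) (e : RealExpr)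
  | seq (p q : Program)
  | cond (b : BoolExpr) (p q : Program)
  | loop (b : BoolExpr) (p : Program)

namespace State

def setNat (σ : State) (x v : ℕ) : State :=
  { σ with natVar := Function.update σ.natVar x v }

def putNat (σ : State) (a i v : ℕ) : State :=
  { σ with natArr := Function.update σ.natArr a (Function.update (σ.natArr a) i v) }

def setReal (σ : State) (x : ℕ) (v : ℝ) : State :=
  { σ with realVar := Function.update σ.realVar x v }

def putReal (σ : State) (a i : ℕ) (v : ℝ) : State :=
  { σ with realArr := Function.update σ.realArr a (Function.update (σ.realArr a) i v) }

end State

/-- `Runs p σ τ t`: started in the state `σ`, the program `p` halts in the state `τ` after exactly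
`t` steps. -/
inductive Runs : Program → State → State → ℕ → Prop where
  | skip (σ : State) : Runs .skip σ σ 1
  | setNat (x : ℕ) (e : NatExpr) (σ : State) :
      Runs (.setNat x e) σ (σ.setNat x (e.eval σ)) (1 + e.cost)
  | putNat (a : ℕ) (i e : NatExpr) (σ : State) :
      Runs (.putNat a i e) σ (σ.putNat a (i.eval σ) (e.eval σ)) (1 + i.cost + e.cost)
  | setReal (x : ℕ) (e : RealExpr) (σ : State) :
      Runs (.setReal x e) σ (σ.setReal x (e.eval σ)) (1 + e.cost)
  | putReal (a : ℕ) (i : NatExpr) (e : RealExpr) (σ : State) :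
      Runs (.putReal a i e) σ (σ.putReal a (i.eval σ) (e.eval σ)) (1 + i.cost + e.cost)
  | seq {p q : Program} {σ τ υ : State} {t u : ℕ} :
      Runs p σ τ t → Runs q τ υ u → Runs (.seq p q) σ υ (t + u)
  | condTrue {b : BoolExpr} {p q : Program} {σ τ : State} {t : ℕ} :
      b.Holds σ → Runs p σ τ t → Runs (.cond b p q) σ τ (1 + b.cost + t)
  | condFalse {b : BoolExpr} {p q : Program} {σ τ : State} {t : ℕ} :
      ¬ b.Holds σ → Runs q σ τ t → Runs (.cond b p q) σ τ (1 + b.cost + t)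
  | loopTrue {b : BoolExpr} {p : Program} {σ τ υ : State} {t u : ℕ} :
      b.Holds σ → Runs p σ τ t → Runs (.loop b p) τ υ u →
      Runs (.loop b p) σ υ (1 + b.cost + t + u)
  | loopFalse {b : BoolExpr} {p : Program} {σ : State} :
      ¬ b.Holds σ → Runs (.loop b p) σ σ (1 + b.cost)

/-- The model is deterministic: final state and number of steps depend only on program and input. -/
theorem Runs.unique {p : Program} {σ τ τ' : State} {t t' : ℕ}
    (h : Runs p σ τ t) (h' : Runs p σ τ' t') : τ = τ' ∧ t = t' := by
  induction h generalizing τ' t' with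
  | skip | setNat | putNat | setReal | putReal => cases h'; exact ⟨rfl, rfl⟩
  | seq _ _ ih₁ ih₂ =>
    cases h' with
    | seq g₁ g₂ =>
      obtain ⟨rfl, rfl⟩ := ih₁ g₁
      obtain ⟨rfl, rfl⟩ := ih₂ g₂
      exact ⟨rfl, rfl⟩
  | condTrue hb _ ih =>
    cases h' with
    | condTrue _ g => obtain ⟨rfl, rfl⟩ := ih g; exact ⟨rfl, rfl⟩
    | condFalse hn _ => exact absurd hb hn
  | condFalse hb _ ih =>
    cases h' with
    | condTrue hn _ => exact absurd hn hb
    | condFalse _ g => obtain ⟨rfl, rfl⟩ := ih g; exact ⟨rfl, rfl⟩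
  | loopTrue hb _ _ ih₁ ih₂ =>
    cases h' with
    | loopTrue _ g₁ g₂ =>
      obtain ⟨rfl, rfl⟩ := ih₁ g₁
      obtain ⟨rfl, rfl⟩ := ih₂ g₂
      exact ⟨rfl, rfl⟩
    | loopFalse hn => exact absurd hb hn
  | loopFalse hb =>
    cases h' with
    | loopTrue hn _ _ => exact absurd hn hb
    | loopFalse _ => exact ⟨rfl, rfl⟩

/-! ### Input and output -/

/-- The array with entries `f 0, …, f (n - 1)`, continued by zeros. -/
def toArray {n : ℕ} (f : Fin n → ℝ) (i : ℕ) : ℝ :=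
  if h : i < n then f ⟨i, h⟩ else 0

/-- The initial state for the points `p 0, …, p (n - 1)` and the unit squares with lower-left
corners `d 0, …, d (m - 1)`: the numbers `n` and `m` are in the natural variables `0` and `1`, the
coordinates of the points in the real arrays `0` and `1`, those of the corners in the real arrays
`2` and `3`, and the rest of the memory is zero. -/
def inputState {n m : ℕ} (p : Fin n → ℝ × ℝ) (d : Fin m → ℝ × ℝ) : State where
  natVar x := if x = 0 then n else if x = 1 then m else 0
  natArr _ _ := 0
  realVar _ := 0
  realArr a :=
    if a = 0 then toArray fun i => (p i).1
    else if a = 1 then toArray fun i => (p i).2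
    else if a = 2 then toArray fun j => (d j).1
    else if a = 3 then toArray fun j => (d j).2
    else fun _ => 0

/-- The final state's answer to whether a cover exists: natural variable `2` is `1` (yes). -/
def State.saysYes (σ : State) : Prop := σ.natVar 2 = 1

/-- The final state's answer to whether a cover exists: natural variable `2` is `0` (no). -/
def State.saysNo (σ : State) : Prop := σ.natVar 2 = 0

/-- The squares selected by the final state: square `j` is selected if entry `j` of the natural
array `0` is `1`. -/
noncomputable def State.selected (σ : State) {m : ℕ} (d : Fin m → ℝ × ℝ) : Finset (ℝ × ℝ) :=
  (Finset.univ.filter fun j : Fin m => σ.natArr 0 j = 1).image d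

end UniqueSquareCover

/-! Take the first point as origin and let `K` be `k` rounded up. Only squares that contain a point
matter, and their corners lie in `(2 * K + 2) ^ 2` cells of the integer grid; squares with corners
in the same cell form a class. Reduce abscissas modulo one and let one vertical line per unit column
sweep to the right, all lines at the same time. When the sweep passes a point `q`, every square is
either past or future.

Among the past squares of one class, if one spans the abscissa of `q`, then all do, and likewise
among the future ones (`mem_interval_of_before`, `mem_interval_of_not_before`). Vertically, if one
square of a class spans `q`, then either all lower ones or all higher ones in that class do
(`mem_interval_monotone`). So the two lowest and the two highest squares of each class on each side
of the sweep already decide whether `q` is covered zero times, once, or at least twice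
(`mem_kernel_or_two_le_depth`). A cover is thus represented by a sequence of collections, one per
sweep position, each of at most `8 * (2 * K + 2) ^ 2` squares (`exists_compatible_sequence`).

Conversely, take any sequence of small collections in which neighbours satisfy `Compatible`. The
depth of a point in the union, capped at two, is then its capped depth in the single collection at
its own position (`min_depth_biUnion`). The union need not be the original cover, but feasibility
and objective depend only on capped depths. Hence the objective is a sum of contributions of
positions, and an optimal solution is a path of largest value in a layered network whose nodes are
pairs of a position and a small collection (`Network.traceSet_spec`, `exists_best_ge_of_cover`).

With `L` squares per collection there are `Y = (m + 1) ^ (L + 1)` nodes. The dynamic program treats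
pairs of nodes, each at a cost of order `(n + 1) * Y`, so the total is of order `(n + 1) * Y ^ 3`
with `L` quadratic in `k`. Natural numbers cannot be multiplied or divided by the machine, so
decoding a node uses repeated subtraction; this fits into the factor `Y`. Correctness of the program
is derived with loop invariants, together with syntactic frames that say what a program cannot
change. -/

namespace UniqueSquareCover

/-! ### Frames: what a program leaves unchanged -/

namespace Program

/-- `p` contains an assignment to the natural variable `x`. -/
def writesNat (x : ℕ) : Program → Bool
  | setNat y _ => x == y
  | seq p q => p.writesNat x || q.writesNat x
  | cond _ p q => p.writesNat x || q.writesNat x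
  | loop _ p => p.writesNat x
  | _ => false

/-- `p` contains an assignment to an entry of the natural array `a`. -/
def writesNatArr (a : ℕ) : Program → Bool
  | putNat b _ _ => a == b
  | seq p q => p.writesNatArr a || q.writesNatArr a
  | cond _ p q => p.writesNatArr a || q.writesNatArr a
  | loop _ p => p.writesNatArr a
  | _ => false

/-- `p` contains an assignment to the real variable `x`. -/
def writesReal (x : ℕ) : Program → Bool
  | setReal y _ => x == y
  | seq p q => p.writesReal x || q.writesReal x
  | cond _ p q => p.writesReal x || q.writesReal x
  | loop _ p => p.writesReal x
  | _ => false

/-- `p` contains an assignment to an entry of the real array `a`. -/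
def writesRealArr (a : ℕ) : Program → Bool
  | putReal b _ _ => a == b
  | seq p q => p.writesRealArr a || q.writesRealArr a
  | cond _ p q => p.writesRealArr a || q.writesRealArr a
  | loop _ p => p.writesRealArr a
  | _ => false

end Program

section StateLemmas

variable (σ : State) (x y a b i v : ℕ) (w : ℝ)

@[simp] theorem State.setNat_natVar :
    (σ.setNat x v).natVar y = if y = x then v else σ.natVar y := by
  simp [State.setNat, Function.update_apply]
@[simp] theorem State.setNat_natArr : (σ.setNat x v).natArr = σ.natArr := rfl
@[simp] theorem State.setNat_realVar : (σ.setNat x v).realVar = σ.realVar := rfl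
@[simp] theorem State.setNat_realArr : (σ.setNat x v).realArr = σ.realArr := rfl
@[simp] theorem State.putNat_natVar : (σ.putNat a i v).natVar = σ.natVar := rfl
@[simp] theorem State.putNat_natArr :
    (σ.putNat a i v).natArr b = if b = a then Function.update (σ.natArr a) i v else σ.natArr b := by
  simp [State.putNat, Function.update_apply]
@[simp] theorem State.putNat_realVar : (σ.putNat a i v).realVar = σ.realVar := rfl
@[simp] theorem State.putNat_realArr : (σ.putNat a i v).realArr = σ.realArr := rfl
@[simp] theorem State.setReal_natVar : (σ.setReal x w).natVar = σ.natVar := rfl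
@[simp] theorem State.setReal_natArr : (σ.setReal x w).natArr = σ.natArr := rfl
@[simp] theorem State.setReal_realVar :
    (σ.setReal x w).realVar y = if y = x then w else σ.realVar y := by
  simp [State.setReal, Function.update_apply]
@[simp] theorem State.setReal_realArr : (σ.setReal x w).realArr = σ.realArr := rfl
@[simp] theorem State.putReal_natVar : (σ.putReal a i w).natVar = σ.natVar := rfl
@[simp] theorem State.putReal_natArr : (σ.putReal a i w).natArr = σ.natArr := rfl
@[simp] theorem State.putReal_realVar : (σ.putReal a i w).realVar = σ.realVar := rfl
@[simp] theorem State.putReal_realArr :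
    (σ.putReal a i w).realArr b =
      if b = a then Function.update (σ.realArr a) i w else σ.realArr b := by
  simp [State.putReal, Function.update_apply]

end StateLemmas

/-- `σ` and `τ` agree on everything `p` contains no assignment to. -/
structure Frame (p : Program) (σ τ : State) : Prop where
  natVar : ∀ x, p.writesNat x = false → τ.natVar x = σ.natVar x
  natArr : ∀ a, p.writesNatArr a = false → τ.natArr a = σ.natArr a
  realVar : ∀ x, p.writesReal x = false → τ.realVar x = σ.realVar x
  realArr : ∀ a, p.writesRealArr a = false → τ.realArr a = σ.realArr a

theorem Frame.refl (p : Program) (σ : State) : Frame p σ σ :=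
  ⟨fun _ _ => rfl, fun _ _ => rfl, fun _ _ => rfl, fun _ _ => rfl⟩

theorem Frame.trans {p : Program} {σ τ υ : State} (h : Frame p σ τ) (g : Frame p τ υ) :
    Frame p σ υ :=
  ⟨fun x hx => (g.natVar x hx).trans (h.natVar x hx),
   fun x hx => (g.natArr x hx).trans (h.natArr x hx),
   fun x hx => (g.realVar x hx).trans (h.realVar x hx),
   fun x hx => (g.realArr x hx).trans (h.realArr x hx)⟩

theorem Frame.mono {p q : Program} {σ τ : State} (h : Frame p σ τ)
    (h₁ : ∀ x, q.writesNat x = false → p.writesNat x = false)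
    (h₂ : ∀ x, q.writesNatArr x = false → p.writesNatArr x = false)
    (h₃ : ∀ x, q.writesReal x = false → p.writesReal x = false)
    (h₄ : ∀ x, q.writesRealArr x = false → p.writesRealArr x = false) : Frame q σ τ :=
  ⟨fun x hx => h.natVar x (h₁ x hx), fun x hx => h.natArr x (h₂ x hx),
   fun x hx => h.realVar x (h₃ x hx), fun x hx => h.realArr x (h₄ x hx)⟩

/-- The frame is a syntactic condition that evaluates to a Boolean. For concrete programs,
preservation of a variable or an array therefore has a proof by `rfl`. -/
theorem Runs.frame {p : Program} {σ τ : State} {t : ℕ} (h : Runs p σ τ t) : Frame p σ τ := by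
  induction h with
  | skip => exact Frame.refl _ _
  | setNat => constructor <;> simp +contextual [Program.writesNat]
  | putNat => constructor <;> simp +contextual [Program.writesNatArr]
  | setReal => constructor <;> simp +contextual [Program.writesReal]
  | putReal => constructor <;> simp +contextual [Program.writesRealArr]
  | seq _ _ h₁ h₂ =>
    refine (h₁.mono ?_ ?_ ?_ ?_).trans (h₂.mono ?_ ?_ ?_ ?_) <;>
      simp +contextual [Program.writesNat, Program.writesNatArr, Program.writesReal,
        Program.writesRealArr]
  | condTrue _ _ h | condFalse _ _ h =>
    refine h.mono ?_ ?_ ?_ ?_ <;>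
      simp +contextual [Program.writesNat, Program.writesNatArr, Program.writesReal,
        Program.writesRealArr]
  | loopTrue _ _ _ h₁ h₂ =>
    refine (h₁.mono ?_ ?_ ?_ ?_).trans h₂ <;>
      simp [Program.writesNat, Program.writesNatArr, Program.writesReal,
        Program.writesRealArr]
  | loopFalse => exact Frame.refl _ _

/-! ### Total correctness with time bounds -/

/-- Started in `σ`, the program `p` halts within `T` steps in a state satisfying `Q`. -/
def Within (p : Program) (T : ℕ) (σ : State) (Q : State → Prop) : Prop :=
  ∃ τ t, Runs p σ τ t ∧ t ≤ T ∧ Q τ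

namespace Within

variable {p q : Program} {T U : ℕ} {σ : State} {Q R : State → Prop}

theorem imp (h : Within p T σ Q) (hTU : T ≤ U) (hQ : ∀ τ, Frame p σ τ → Q τ → R τ) :
    Within p U σ R := by
  obtain ⟨τ, t, hr, ht, hq⟩ := h
  exact ⟨τ, t, hr, ht.trans hTU, hQ τ hr.frame hq⟩

theorem time_mono (h : Within p T σ Q) (hTU : T ≤ U) : Within p U σ Q :=
  h.imp hTU fun _ _ hq => hq

theorem skip (h : Q σ) : Within .skip 1 σ Q := ⟨_, _, .skip σ, le_rfl, h⟩

theorem setNat {x : ℕ} {e : NatExpr} (h : Q (σ.setNat x (e.eval σ))) :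
    Within (.setNat x e) (1 + e.cost) σ Q := ⟨_, _, .setNat x e σ, le_rfl, h⟩

theorem putNat {a : ℕ} {i e : NatExpr} (h : Q (σ.putNat a (i.eval σ) (e.eval σ))) :
    Within (.putNat a i e) (1 + i.cost + e.cost) σ Q := ⟨_, _, .putNat a i e σ, le_rfl, h⟩

theorem setReal {x : ℕ} {e : RealExpr} (h : Q (σ.setReal x (e.eval σ))) :
    Within (.setReal x e) (1 + e.cost) σ Q := ⟨_, _, .setReal x e σ, le_rfl, h⟩

theorem putReal {a : ℕ} {i : NatExpr} {e : RealExpr}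
    (h : Q (σ.putReal a (i.eval σ) (e.eval σ))) :
    Within (.putReal a i e) (1 + i.cost + e.cost) σ Q := ⟨_, _, .putReal a i e σ, le_rfl, h⟩

theorem seq (h : Within p T σ fun τ => Within q U τ Q) : Within (.seq p q) (T + U) σ Q := by
  obtain ⟨τ, t, hr, ht, υ, u, hu, hut, hq⟩ := h
  exact ⟨υ, t + u, .seq hr hu, by omega, hq⟩

theorem cond {b : BoolExpr} (h₁ : b.Holds σ → Within p T σ Q)
    (h₂ : ¬ b.Holds σ → Within q U σ Q) :
    Within (.cond b p q) (1 + b.cost + (T + U)) σ Q := by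
  by_cases hb : b.Holds σ
  · obtain ⟨τ, t, hr, ht, hq⟩ := h₁ hb
    exact ⟨τ, _, .condTrue hb hr, by omega, hq⟩
  · obtain ⟨τ, t, hr, ht, hq⟩ := h₂ hb
    exact ⟨τ, _, .condFalse hb hr, by omega, hq⟩

/-- A while loop whose variant `V` decreases in every iteration. -/
theorem loop {b : BoolExpr} (Inv : State → Prop) (V : State → ℕ)
    (hstep : ∀ τ, Inv τ → b.Holds τ → Within p T τ fun υ => Inv υ ∧ V υ < V τ)
    (hσ : Inv σ) :
    Within (.loop b p) (V σ * (1 + b.cost + T) + (1 + b.cost)) σ fun τ => Inv τ ∧ ¬ b.Holds τ := by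
  induction hv : V σ using Nat.strong_induction_on generalizing σ with
  | _ v ih =>
  by_cases hb : b.Holds σ
  · obtain ⟨τ, t, hr, ht, hτ, hlt⟩ := hstep σ hσ hb
    obtain ⟨υ, u, hu, hut, hq⟩ := ih _ (hv ▸ hlt) hτ rfl
    refine ⟨υ, _, .loopTrue hb hr hu, ?_, hq⟩
    -- The variant dropped by at least one, which pays for the iteration just made.
    have : (V τ + 1) * (1 + b.cost + T) ≤ v * (1 + b.cost + T) :=
      Nat.mul_le_mul_right _ (by omega)
    rw [Nat.add_one_mul] at this
    omega
  · exact ⟨σ, _, .loopFalse hb, by omega, hσ, hb⟩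

end Within

/-- `for x := 0 to e - 1 do p`. -/
def forLoop (x : ℕ) (e : NatExpr) (p : Program) : Program :=
  .seq (.setNat x (.const 0))
    (.loop (.natLe (.add (.var x) (.const 1)) e)
      (.seq p (.setNat x (.add (.var x) (.const 1)))))

/-- The number `Y` bounds the number of iterations and is positive, so the summand `16 + 2 * e.cost`
also absorbs the initialisation and the last, failing test. The loop re-evaluates `e` each time,
hence the demand that `e` keep its value in all states that differ from `σ` only where the loop
writes. -/
theorem Within.forLoop {x : ℕ} {e : NatExpr} {p : Program} {T b Y : ℕ} {σ : State}
    (Inv : ℕ → State → Prop) (hx : p.writesNat x = false) (hbY : b ≤ Y) (hY : 1 ≤ Y)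
    (he : ∀ τ, Frame (forLoop x e p) σ τ → e.eval τ = b)
    (h0 : Inv 0 (σ.setNat x 0))
    (hstep : ∀ i τ, i < b → Frame (UniqueSquareCover.forLoop x e p) σ τ → τ.natVar x = i →
      Inv i τ → Within p T τ fun υ => Inv (i + 1) (υ.setNat x (i + 1))) :
    Within (forLoop x e p) (Y * (T + 16 + 2 * e.cost)) σ (Inv b) := by
  have hF : Frame (UniqueSquareCover.forLoop x e p) σ (σ.setNat x 0) := by
    constructor <;>
      simp +contextual [UniqueSquareCover.forLoop, Program.writesNat]
  have hFp : ∀ τ υ, Frame p τ υ → Frame (UniqueSquareCover.forLoop x e p) τ υ := by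
    intro τ υ h
    refine h.mono ?_ ?_ ?_ ?_ <;>
      simp +contextual [UniqueSquareCover.forLoop, Program.writesNat, Program.writesNatArr,
        Program.writesReal, Program.writesRealArr]
  have hFs : ∀ τ v, Frame (UniqueSquareCover.forLoop x e p) τ (τ.setNat x v) := by
    intro τ v
    constructor <;>
      simp +contextual [UniqueSquareCover.forLoop, Program.writesNat]
  -- The bound on the counter is carried along so that the failing test forces the counter to be
  -- exactly `b`.
  let J : State → Prop := fun τ => Frame (UniqueSquareCover.forLoop x e p) σ τ ∧
    τ.natVar x ≤ b ∧ Inv (τ.natVar x) τ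
  have hloop := Within.loop (p := .seq p (.setNat x (.add (.var x) (.const 1))))
    (b := .natLe (.add (.var x) (.const 1)) e) (T := T + 4) (σ := σ.setNat x 0) J
    (fun τ => b - τ.natVar x) (by
      rintro τ ⟨hFτ, hle, hI⟩ hb
      have hlt : τ.natVar x < b := by
        have : τ.natVar x + 1 ≤ e.eval τ := hb
        rwa [he τ hFτ] at this
      refine Within.seq (((hstep _ τ hlt hFτ rfl hI).imp le_rfl ?_))
      intro υ hυ hI'
      have hxυ : υ.natVar x = τ.natVar x := hυ.natVar x hx
      refine Within.setNat (e := .add (.var x) (.const 1)) ?_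
      simp only [NatExpr.eval, hxυ]
      refine ⟨⟨(hFτ.trans (hFp _ _ hυ)).trans (hFs _ _), ?_, ?_⟩, ?_⟩
      · simpa using hlt
      · simpa using hI'
      · simp; omega)
    ⟨hF, by simp, by simpa using h0⟩
  refine Within.time_mono (Within.seq (U := b * (9 + e.cost + T) + (5 + e.cost))
    (Within.setNat (e := .const 0) ?_)) ?_
  · refine hloop.imp ?_ ?_
    · simp only [State.setNat_natVar, if_true, Nat.sub_zero, BoolExpr.cost, NatExpr.cost]
      exact Nat.add_le_add (Nat.mul_le_mul_left _ (by omega)) (by omega)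
    · rintro τ - ⟨⟨hFτ, hle, hI⟩, hb⟩
      have : ¬ τ.natVar x + 1 ≤ e.eval τ := hb
      rw [he τ hFτ] at this
      have hxb : τ.natVar x = b := by omega
      rwa [hxb] at hI
  · simp only [NatExpr.cost]
    have h1 : b * (9 + e.cost + T) ≤ Y * (9 + e.cost + T) := Nat.mul_le_mul_right _ hbY
    have h2 : 7 + e.cost ≤ Y * (7 + e.cost) := Nat.le_mul_of_pos_left _ hY
    calc _ ≤ Y * (9 + e.cost + T) + Y * (7 + e.cost) := by omega
      _ = _ := by ring


/-! ### Sequences of small sub-collections -/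

section Combinatorics

open Classical in
/-- The number of members of `S` that are incident to `q`. -/
noncomputable def depth (cov : ℕ → ℕ → Prop) (S : Finset ℕ) (q : ℕ) : ℕ :=
  (S.filter fun j => cov j q).card

variable {cov : ℕ → ℕ → Prop} {cut : ℕ → ℕ} {n : ℕ}

theorem depth_mono {A B : Finset ℕ} {q : ℕ} (h : ∀ j ∈ A, cov j q → j ∈ B) :
    depth cov A q ≤ depth cov B q := by
  classical
  refine Finset.card_le_card fun j hj => ?_
  rw [Finset.mem_filter] at hj ⊢
  exact ⟨h j hj.1 hj.2, hj.2⟩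

/-- A subset of at least the same finite cardinality is the whole set. This lets the machine decide
an inclusion by comparing two counts. -/
theorem depth_le_depth_inter {A B : Finset ℕ} {q : ℕ} :
    depth cov A q ≤ depth cov (A ∩ B) q ↔ ∀ j ∈ A, cov j q → j ∈ B := by
  classical
  constructor
  · intro h j hj hc
    have hsub : (A ∩ B).filter (fun j => cov j q) ⊆ A.filter fun j => cov j q :=
      Finset.filter_subset_filter _ Finset.inter_subset_left
    have heq := Finset.eq_of_subset_of_card_le hsub h
    have : j ∈ A.filter fun j => cov j q := Finset.mem_filter.2 ⟨hj, hc⟩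
    rw [← heq] at this
    exact (Finset.mem_inter.1 (Finset.mem_filter.1 this).1).2
  · intro h
    exact depth_mono fun j hj hc => Finset.mem_inter.2 ⟨hj, h j hj hc⟩

theorem two_le_depth {A : Finset ℕ} {q a b : ℕ} (hab : a ≠ b) (ha : a ∈ A) (hb : b ∈ A)
    (hca : cov a q) (hcb : cov b q) : 2 ≤ depth cov A q := by
  classical
  have : ({a, b} : Finset ℕ) ⊆ A.filter fun j => cov j q := by
    intro x hx
    rw [Finset.mem_insert, Finset.mem_singleton] at hx
    rcases hx with rfl | rfl <;> simp [*]
  exact (Finset.card_pair hab).ge.trans (Finset.card_le_card this)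

/-- The collections `A` and `B` may follow each other, `B` in position `r`: whatever `A` loses is
irrelevant for the points with cut at least `r`, and whatever `B` gains is irrelevant for the other
points. -/
def Compatible (cov : ℕ → ℕ → Prop) (cut : ℕ → ℕ) (n r : ℕ) (A B : Finset ℕ) : Prop :=
  ∀ q < n,
    (r ≤ cut q → depth cov A q ≤ depth cov (A ∩ B) q ∨ 2 ≤ depth cov B q) ∧
    (cut q < r → depth cov B q ≤ depth cov (A ∩ B) q ∨ 2 ≤ depth cov A q)

/-- Covering squares are handed on from each collection to the next unless the next has depth two.
Once depth two is reached it persists, because a later step either keeps all covering squares or has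
depth two itself. -/
theorem subset_or_two_le_depth {V : ℕ → Finset ℕ} {q k : ℕ}
    (h : ∀ i < k, (∀ j ∈ V i, cov j q → j ∈ V (i + 1)) ∨ 2 ≤ depth cov (V (i + 1)) q) :
    (∀ j ∈ V 0, cov j q → j ∈ V k) ∨ 2 ≤ depth cov (V k) q := by
  induction k with
  | zero => exact Or.inl fun j hj _ => hj
  | succ k ih =>
    rcases h k (Nat.lt_succ_self k) with hs | h2
    · rcases ih fun i hi => h i (Nat.lt_succ_of_lt hi) with h0 | h2
      · exact Or.inl fun j hj hc => hs j (h0 j hj hc) hc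
      · exact Or.inr (h2.trans (depth_mono hs))
    · exact Or.inr h2

/-- Along a compatible sequence, the union has the same depth, up to `2`, at a point as the member
at the position given by the cut of the point. -/
theorem min_depth_biUnion {m : ℕ} {W : ℕ → Finset ℕ}
    (h : ∀ i < m, Compatible cov cut n (i + 1) (W i) (W (i + 1))) {q : ℕ} (hq : q < n)
    (hcut : cut q ≤ m) :
    min (depth cov ((Finset.range (m + 1)).biUnion W) q) 2 =
      min (depth cov (W (cut q)) q) 2 := by
  -- Collections before the position of `q` are followed forwards, those after it backwards; the two
  -- halves of `Compatible` serve the two directions.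
  have key : ∀ i ≤ m, (∀ j ∈ W i, cov j q → j ∈ W (cut q)) ∨ 2 ≤ depth cov (W (cut q)) q := by
    intro i hi
    rcases le_total i (cut q) with hic | hic
    · have := subset_or_two_le_depth (cov := cov) (q := q) (V := fun k => W (i + k))
        (k := cut q - i) (by
          intro k hk
          have := (h (i + k) (by omega) q hq).1 (by omega)
          rwa [depth_le_depth_inter] at this)
      simpa [Nat.add_sub_cancel' hic] using this
    · have := subset_or_two_le_depth (cov := cov) (q := q) (V := fun k => W (i - k))
        (k := i - cut q) (by
          intro k hk
          have h1 := (h (i - (k + 1)) (by omega) q hq).2 (by omega)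
          rw [Finset.inter_comm, depth_le_depth_inter] at h1
          have e : i - (k + 1) + 1 = i - k := by omega
          rwa [e] at h1)
      have e : i - (i - cut q) = cut q := by omega
      simpa [e] using this
  have hsub : depth cov (W (cut q)) q ≤ depth cov ((Finset.range (m + 1)).biUnion W) q :=
    depth_mono fun j hj _ => Finset.mem_biUnion.2 ⟨cut q, by simp; omega, hj⟩
  by_cases h2 : 2 ≤ depth cov (W (cut q)) q
  · omega
  · have : depth cov ((Finset.range (m + 1)).biUnion W) q ≤ depth cov (W (cut q)) q := by
      refine depth_mono fun j hj hc => ?_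
      obtain ⟨i, hi, hj⟩ := Finset.mem_biUnion.1 hj
      exact (key i (by simpa [Nat.lt_succ_iff] using hi)).resolve_right h2 j hj hc
    omega

/-! ### Kernels: the two lowest and the two highest members of every class -/

variable {ι α : Type*} [LinearOrder α]

open Classical in
/-- The members of `A` below which there is at most one further member of the same class. -/
noncomputable def lowKernel (cl : ℕ → ι) (key : ℕ → α) (A : Finset ℕ) : Finset ℕ :=
  A.filter fun j => (A.filter fun i => cl i = cl j ∧ key i < key j).card < 2

theorem lowKernel_subset (cl : ℕ → ι) (key : ℕ → α) (A : Finset ℕ) : lowKernel cl key A ⊆ A :=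
  Finset.filter_subset _ _

/-- Removing other members can only lower the number of competitors below `j`. So a square never
enters a kernel again through growth of the collection, which makes the kernels along the sweep
consistent. -/
theorem mem_lowKernel_of_subset {cl : ℕ → ι} {key : ℕ → α} {A B : Finset ℕ} (h : B ⊆ A) {j : ℕ}
    (hj : j ∈ B) (hk : j ∈ lowKernel cl key A) : j ∈ lowKernel cl key B := by
  classical
  rw [lowKernel, Finset.mem_filter] at hk ⊢
  exact ⟨hj, (Finset.card_le_card (Finset.filter_subset_filter _ h)).trans_lt hk.2⟩

theorem card_lowKernel_le {cl : ℕ → ι} {key : ℕ → α} (hkey : Function.Injective key)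
    {A : Finset ℕ} {C : Finset ι} (hC : ∀ j ∈ A, cl j ∈ C) :
    (lowKernel cl key A).card ≤ 2 * C.card := by
  classical
  refine (Finset.card_le_mul_card_image (f := cl) _ 2 ?_).trans
    (Nat.mul_le_mul_left _ (Finset.card_le_card ?_))
  · intro c _
    set F := (lowKernel cl key A).filter fun x => cl x = c with hF
    rcases F.eq_empty_or_nonempty with h | h
    · simp [h]
    · obtain ⟨z, hz, hmax⟩ := F.exists_max_image key h
      have hz' := Finset.mem_filter.1 hz
      have hlt := (Finset.mem_filter.1 hz'.1).2
      -- All kernel members of the class other than the highest one, `z`, lie below `z`, and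
      -- membership of `z` in the kernel allows at most one of them.
      have hsub : F.erase z ⊆ A.filter fun i => cl i = cl z ∧ key i < key z := by
        intro x hx
        have hx' := Finset.mem_filter.1 (Finset.mem_of_mem_erase hx)
        refine Finset.mem_filter.2 ⟨lowKernel_subset _ _ _ hx'.1, hx'.2.trans hz'.2.symm, ?_⟩
        exact lt_of_le_of_ne (hmax x (Finset.mem_of_mem_erase hx))
          fun e => Finset.ne_of_mem_erase hx (hkey e)
      have := Finset.card_le_card hsub
      rw [Finset.card_erase_of_mem hz] at this
      omega
  · intro c hc
    obtain ⟨j, hj, rfl⟩ := Finset.mem_image.1 hc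
    exact hC j (lowKernel_subset _ _ _ hj)

/-- A square outside the kernel has at least two classmates below it; the lowest two of these are in
the kernel themselves. -/
theorem exists_two_lowKernel {cl : ℕ → ι} {key : ℕ → α} {A : Finset ℕ} {j : ℕ} (hj : j ∈ A)
    (hjk : j ∉ lowKernel cl key A) :
    ∃ a b, a ≠ b ∧ (a ∈ lowKernel cl key A ∧ cl a = cl j ∧ key a < key j) ∧
      (b ∈ lowKernel cl key A ∧ cl b = cl j ∧ key b < key j) := by
  classical
  set B := A.filter fun i => cl i = cl j ∧ key i < key j with hB
  have hcard : 2 ≤ B.card := by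
    by_contra h
    exact hjk (Finset.mem_filter.2 ⟨hj, not_le.1 h⟩)
  obtain ⟨a, ha, hamin⟩ := B.exists_min_image key (Finset.card_pos.1 (by omega))
  obtain ⟨b, hb, hbmin⟩ := (B.erase a).exists_min_image key
    (Finset.card_pos.1 (by rw [Finset.card_erase_of_mem ha]; omega))
  have ha' := Finset.mem_filter.1 ha
  have hb' := Finset.mem_filter.1 (Finset.mem_of_mem_erase hb)
  refine ⟨a, b, (Finset.ne_of_mem_erase hb).symm, ⟨?_, ha'.2⟩, ⟨?_, hb'.2⟩⟩
  · refine Finset.mem_filter.2 ⟨ha'.1, ?_⟩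
    rw [Finset.card_eq_zero.2]
    · omega
    · refine Finset.filter_eq_empty_iff.2 fun x hx h => ?_
      exact absurd (hamin x (Finset.mem_filter.2 ⟨hx, h.1.trans ha'.2.1, h.2.trans ha'.2.2⟩))
        (not_le.2 h.2)
  · refine Finset.mem_filter.2 ⟨hb'.1, ?_⟩
    refine lt_of_le_of_lt (Finset.card_le_card (t := {a}) ?_) (by simp)
    intro x hx
    have hx := Finset.mem_filter.1 hx
    rw [Finset.mem_singleton]
    by_contra hxa
    exact absurd (hbmin x (Finset.mem_erase.2 ⟨hxa, Finset.mem_filter.2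
      ⟨hx.1, hx.2.1.trans hb'.2.1, hx.2.2.trans hb'.2.2⟩⟩)) (not_le.2 hx.2.2)

/-- The members of `A` that are among the two lowest or among the two highest of their class; the
height of a member is `y`, and ties are broken by the index. -/
noncomputable def kernel (cl : ℕ → ι) (y : ℕ → ℝ) (A : Finset ℕ) : Finset ℕ :=
  lowKernel cl (fun j => toLex (y j, j)) A ∪
    lowKernel cl (fun j => OrderDual.toDual (toLex (y j, j))) A

theorem injective_toLex_height (y : ℕ → ℝ) : Function.Injective fun j => toLex (y j, j) :=
  fun _ _ h => (Prod.ext_iff.1 (toLex_inj.1 h)).2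

theorem kernel_subset (cl : ℕ → ι) (y : ℕ → ℝ) (A : Finset ℕ) : kernel cl y A ⊆ A :=
  Finset.union_subset (lowKernel_subset _ _ _) (lowKernel_subset _ _ _)

theorem mem_kernel_of_subset {cl : ℕ → ι} {y : ℕ → ℝ} {A B : Finset ℕ} (h : B ⊆ A) {j : ℕ}
    (hj : j ∈ B) (hk : j ∈ kernel cl y A) : j ∈ kernel cl y B := by
  rw [kernel, Finset.mem_union] at hk ⊢
  exact hk.imp (mem_lowKernel_of_subset h hj) (mem_lowKernel_of_subset h hj)

theorem card_kernel_le {cl : ℕ → ι} {y : ℕ → ℝ} {A : Finset ℕ} {C : Finset ι}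
    (hC : ∀ j ∈ A, cl j ∈ C) : (kernel cl y A).card ≤ 4 * C.card := by
  have h1 := card_lowKernel_le (injective_toLex_height y) hC
  have h2 := card_lowKernel_le
    (OrderDual.toDual.injective.comp (injective_toLex_height y)) hC
  have h3 := Finset.card_union_le (lowKernel cl (fun j => toLex (y j, j)) A)
    (lowKernel cl (fun j => OrderDual.toDual (toLex (y j, j))) A)
  simp only [kernel]
  simp only [Function.comp_def] at h2
  omega

/-- A covering square that is dropped has two kernel classmates below it and two above it. By
monotonicity one of these pairs covers `q`, so nothing is lost from the depth capped at two. -/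
theorem mem_kernel_or_two_le_depth {cl : ℕ → ι} {y : ℕ → ℝ} {A : Finset ℕ} {j q : ℕ} (hj : j ∈ A)
    (h : (∀ i ∈ A, cl i = cl j → y i ≤ y j → cov i q) ∨
      (∀ i ∈ A, cl i = cl j → y j ≤ y i → cov i q)) :
    j ∈ kernel cl y A ∨ 2 ≤ depth cov (kernel cl y A) q := by
  by_contra hn
  obtain ⟨hjk, h2⟩ := not_or.1 hn
  rw [kernel, Finset.mem_union, not_or] at hjk
  have hle : ∀ i, toLex (y i, i) < toLex (y j, j) → y i ≤ y j := fun i hi =>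
    (Prod.Lex.toLex_lt_toLex.1 hi).elim le_of_lt fun h => h.1.le
  have hge : ∀ i, toLex (y j, j) < toLex (y i, i) → y j ≤ y i := fun i hi =>
    (Prod.Lex.toLex_lt_toLex.1 hi).elim le_of_lt fun h => h.1.le
  rcases h with h | h
  · obtain ⟨a, b, hab, ⟨ha, hac, hal⟩, ⟨hb, hbc, hbl⟩⟩ :=
      exists_two_lowKernel hj hjk.1
    exact h2 (two_le_depth hab (Finset.mem_union_left _ ha) (Finset.mem_union_left _ hb)
      (h a (lowKernel_subset _ _ _ ha) hac (hle a hal))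
      (h b (lowKernel_subset _ _ _ hb) hbc (hle b hbl)))
  · obtain ⟨a, b, hab, ⟨ha, hac, hal⟩, ⟨hb, hbc, hbl⟩⟩ :=
      exists_two_lowKernel hj hjk.2
    exact h2 (two_le_depth hab (Finset.mem_union_right _ ha) (Finset.mem_union_right _ hb)
      (h a (lowKernel_subset _ _ _ ha) hac (hge a (OrderDual.toDual_lt_toDual.1 hal)))
      (h b (lowKernel_subset _ _ _ hb) hbc (hge b (OrderDual.toDual_lt_toDual.1 hbl))))

/-- A collection in which, on either side of every cut, incidence is monotone in the height within
every class, is represented by a compatible sequence of small sub-collections. -/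
theorem exists_compatible_sequence {cl : ℕ → ι} {y : ℕ → ℝ} {ρ : ℕ → ℕ} {S : Finset ℕ}
    {C : Finset ι} (hC : ∀ j ∈ S, cl j ∈ C)
    (hpast : ∀ q < n, ∀ j ∈ S, cov j q → ρ j < cut q →
      (∀ i ∈ S, ρ i < cut q → cl i = cl j → y i ≤ y j → cov i q) ∨
      (∀ i ∈ S, ρ i < cut q → cl i = cl j → y j ≤ y i → cov i q))
    (hfuture : ∀ q < n, ∀ j ∈ S, cov j q → cut q ≤ ρ j →
      (∀ i ∈ S, cut q ≤ ρ i → cl i = cl j → y i ≤ y j → cov i q) ∨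
      (∀ i ∈ S, cut q ≤ ρ i → cl i = cl j → y j ≤ y i → cov i q)) :
    ∃ W : ℕ → Finset ℕ, (∀ r, W r ⊆ S ∧ (W r).card ≤ 8 * C.card) ∧
      (∀ r, Compatible cov cut n (r + 1) (W r) (W (r + 1))) ∧
      ∀ q < n, min (depth cov S q) 2 = min (depth cov (W (cut q)) q) 2 := by
  classical
  let P : ℕ → Finset ℕ := fun r => S.filter fun j => ρ j < r
  let F : ℕ → Finset ℕ := fun r => S.filter fun j => r ≤ ρ j
  -- Two highest and two lowest squares, for each class and on each side of position `r`: eight per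
  -- class.
  let W : ℕ → Finset ℕ := fun r => kernel cl y (P r) ∪ kernel cl y (F r)
  have hPS : ∀ r, P r ⊆ S := fun r => Finset.filter_subset _ _
  have hFS : ∀ r, F r ⊆ S := fun r => Finset.filter_subset _ _
  have hP : ∀ q < n, ∀ r ≤ cut q, ∀ j ∈ S, ρ j < r → cov j q →
      j ∈ W r ∨ 2 ≤ depth cov (W r) q := by
    intro q hq r hr j hj hρ hc
    have := mem_kernel_or_two_le_depth (cov := cov) (cl := cl) (y := y) (A := P r) (q := q)
      (Finset.mem_filter.2 ⟨hj, hρ⟩)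
      ((hpast q hq j hj hc (hρ.trans_le hr)).imp
        (fun h i hi => h i (hPS r hi) ((Finset.mem_filter.1 hi).2.trans_le hr))
        (fun h i hi => h i (hPS r hi) ((Finset.mem_filter.1 hi).2.trans_le hr)))
    exact this.imp (Finset.mem_union_left _)
      fun h => h.trans (depth_mono fun i hi _ => Finset.mem_union_left _ hi)
  have hF : ∀ q < n, ∀ r, cut q ≤ r → ∀ j ∈ S, r ≤ ρ j → cov j q →
      j ∈ W r ∨ 2 ≤ depth cov (W r) q := by
    intro q hq r hr j hj hρ hc
    have := mem_kernel_or_two_le_depth (cov := cov) (cl := cl) (y := y) (A := F r) (q := q)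
      (Finset.mem_filter.2 ⟨hj, hρ⟩)
      ((hfuture q hq j hj hc (hr.trans hρ)).imp
        (fun h i hi => h i (hFS r hi) (hr.trans (Finset.mem_filter.1 hi).2))
        (fun h i hi => h i (hFS r hi) (hr.trans (Finset.mem_filter.1 hi).2)))
    exact this.imp (Finset.mem_union_right _)
      fun h => h.trans (depth_mono fun i hi _ => Finset.mem_union_right _ hi)
  have hWS : ∀ r, W r ⊆ S := fun r =>
    Finset.union_subset ((kernel_subset _ _ _).trans (hPS r)) ((kernel_subset _ _ _).trans (hFS r))
  have hWP : ∀ r j, j ∈ W r → ρ j < r → j ∈ kernel cl y (P r) := by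
    intro r j hj hρ
    refine (Finset.mem_union.1 hj).resolve_right fun h => ?_
    have := (Finset.mem_filter.1 (kernel_subset _ _ _ h)).2
    omega
  have hWF : ∀ r j, j ∈ W r → r ≤ ρ j → j ∈ kernel cl y (F r) := by
    intro r j hj hρ
    refine (Finset.mem_union.1 hj).resolve_left fun h => ?_
    have := (Finset.mem_filter.1 (kernel_subset _ _ _ h)).2
    omega
  refine ⟨W, fun r => ⟨hWS r, ?_⟩, ?_, ?_⟩
  · have h1 : (kernel cl y (P r)).card ≤ _ := card_kernel_le fun j hj => hC j (hPS r hj)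
    have h2 : (kernel cl y (F r)).card ≤ _ := card_kernel_le fun j hj => hC j (hFS r hj)
    have h3 := Finset.card_union_le (kernel cl y (P r)) (kernel cl y (F r))
    change (kernel cl y (P r) ∪ kernel cl y (F r)).card ≤ _
    omega
  · intro r q hq
    refine ⟨fun hr => ?_, fun hr => ?_⟩
    · rw [depth_le_depth_inter]
      by_contra hn
      obtain ⟨h1, h2⟩ := not_or.1 hn
      refine h1 fun j hj hc => ?_
      -- A past square is retained by the kernel argument at position `r + 1`. A future square was
      -- in the kernel of `F r` and stays in that of the smaller set `F (r + 1)`.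
      by_cases hρ : ρ j < r + 1
      · exact (hP q hq _ hr j (hWS r hj) hρ hc).resolve_right h2
      · refine Finset.mem_union_right _ (mem_kernel_of_subset (A := F r) ?_ ?_
          (hWF r j hj (by omega)))
        · intro i hi
          have := Finset.mem_filter.1 hi
          exact Finset.mem_filter.2 ⟨this.1, by omega⟩
        · exact Finset.mem_filter.2 ⟨hWS r hj, by omega⟩
    · rw [Finset.inter_comm, depth_le_depth_inter]
      by_contra hn
      obtain ⟨h1, h2⟩ := not_or.1 hn
      refine h1 fun j hj hc => ?_
      by_cases hρ : r ≤ ρ j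
      · exact (hF q hq _ (by omega) j (hWS _ hj) hρ hc).resolve_right h2
      · refine Finset.mem_union_left _ (mem_kernel_of_subset (A := P (r + 1)) ?_ ?_
          (hWP (r + 1) j hj (by omega)))
        · intro i hi
          have := Finset.mem_filter.1 hi
          exact Finset.mem_filter.2 ⟨this.1, by omega⟩
        · exact Finset.mem_filter.2 ⟨hWS _ hj, by omega⟩
  · intro q hq
    have h1 : depth cov (W (cut q)) q ≤ depth cov S q := depth_mono fun j hj _ => hWS _ hj
    by_cases h2 : 2 ≤ depth cov (W (cut q)) q
    · omega
    · have : depth cov S q ≤ depth cov (W (cut q)) q := by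
        refine depth_mono fun j hj hc => ?_
        by_cases hρ : ρ j < cut q
        · exact (hP q hq _ le_rfl j hj hρ hc).resolve_right h2
        · exact (hF q hq _ le_rfl j hj (by omega) hc).resolve_right h2
      omega

end Combinatorics


/-! ### Unit squares modulo one -/

section Geometry

/-- Square `j` contains point `q`; the coordinates of the points are in the rows `0` and `1`
of `X`, those of the lower-left corners of the squares in the rows `2` and `3`. -/
def Covers (X : ℕ → ℕ → ℝ) (j q : ℕ) : Prop :=
  (X 2 j ≤ X 0 q ∧ X 0 q ≤ X 2 j + 1) ∧ X 3 j ≤ X 1 q ∧ X 1 q ≤ X 3 j + 1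

/-- Subtract `1` from a real that is at least `1`. -/
noncomputable def decrease (f : ℝ) : ℝ := if 1 ≤ f then f - 1 else f

/-- The fractional part of `x`, provided that `-(K + 1) ≤ x < K + 1`. -/
noncomputable def offset (K : ℕ) (x : ℝ) : ℝ := decrease^[2 * K + 1] (x + (K + 1 : ℕ))

/-- The machine has no rounding, so fractional parts come from subtracting one a fixed number of
times; once below one, the value no longer changes. -/
theorem iterate_decrease {R : ℕ} {x : ℝ} (h0 : 0 ≤ x) (h1 : x < R + 1) :
    decrease^[R] x = Int.fract x := by
  induction R generalizing x with
  | zero => simpa using (Int.fract_eq_self.2 ⟨h0, by simpa using h1⟩).symm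
  | succ R ih =>
    rw [Function.iterate_succ_apply]
    push_cast at h1
    by_cases h : 1 ≤ x
    · rw [decrease, if_pos h, ih (by linarith) (by linarith), Int.fract_sub_one]
    · rw [decrease, if_neg h, ih h0 (by have : (0 : ℝ) ≤ R := R.cast_nonneg; linarith)]

theorem offset_eq_fract {K : ℕ} {x : ℝ} (h0 : -(K + 1 : ℝ) ≤ x) (h1 : x < K + 1) :
    offset K x = Int.fract x := by
  rw [offset, iterate_decrease, Int.fract_add_natCast] <;> push_cast <;> linarith

/-- At its offset, the sweep line passes square `j` before it passes point `q`. -/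
def Before (K : ℕ) (X : ℕ → ℕ → ℝ) (j q : ℕ) : Prop :=
  offset K (X 2 j - X 0 0) < offset K (X 0 q - X 0 0) ∨
    (offset K (X 2 j - X 0 0) = offset K (X 0 q - X 0 0) ∧ X 0 q ≤ X 2 j)

open Classical in
/-- The number of squares the sweep line passes before it passes point `q`. -/
noncomputable def cutIndex (K : ℕ) (X : ℕ → ℕ → ℝ) (m q : ℕ) : ℕ :=
  ((Finset.range m).filter fun j => Before K X j q).card

theorem cutIndex_le (K : ℕ) (X : ℕ → ℕ → ℝ) (m q : ℕ) : cutIndex K X m q ≤ m := by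
  classical
  simpa [cutIndex] using Finset.card_filter_le (Finset.range m) fun j => Before K X j q

open Classical in
/-- The number of squares the sweep line passes before it passes square `j`. -/
noncomputable def rank (K : ℕ) (X : ℕ → ℕ → ℝ) (m j : ℕ) : ℕ :=
  ((Finset.range m).filter fun i => offset K (X 2 i - X 0 0) < offset K (X 2 j - X 0 0) ∨
    (offset K (X 2 i - X 0 0) = offset K (X 2 j - X 0 0) ∧ X 2 j < X 2 i)).card

/-- Both numbers count initial segments of the same total preorder: by offset, ties by decreasing
abscissa. If `j` is passed before `q`, then so are `j` and everything strictly preceding `j`;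
otherwise everything passed before `q` strictly precedes `j`. Only the order of the offsets is used,
so squares far from all points do no harm. -/
theorem rank_lt_cutIndex {K : ℕ} {X : ℕ → ℕ → ℝ} {m j q : ℕ} (hj : j < m) :
    rank K X m j < cutIndex K X m q ↔ Before K X j q := by
  classical
  constructor
  · intro h
    by_contra hn
    refine absurd h (not_lt.2 (Finset.card_le_card fun i hi => ?_))
    rw [Finset.mem_filter] at hi ⊢
    refine ⟨hi.1, ?_⟩
    simp only [Before, not_or, not_and, not_lt, not_le] at hn
    rcases hi.2 with h1 | ⟨h1, h2⟩
    · exact Or.inl (h1.trans_le hn.1)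
    · rcases hn.1.lt_or_eq with h3 | h3
      · exact Or.inl (h1 ▸ h3)
      · exact Or.inr ⟨h1.trans h3, (hn.2 h3.symm).trans_le h2⟩
  · intro h
    refine Finset.card_lt_card ((Finset.ssubset_iff_of_subset fun i hi => ?_).2 ⟨j, ?_, ?_⟩)
    · rw [Finset.mem_filter] at hi ⊢
      refine ⟨hi.1, ?_⟩
      rcases hi.2 with h1 | ⟨h1, h2⟩ <;> rcases h with h3 | ⟨h3, h4⟩
      · exact Or.inl (h1.trans h3)
      · exact Or.inl (h3 ▸ h1)
      · exact Or.inl (h1 ▸ h3)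
      · exact Or.inr ⟨h1.trans h3, h4.trans h2.le⟩
    · exact Finset.mem_filter.2 ⟨Finset.mem_range.2 hj, h⟩
    · simp

theorem floor_eq_or_eq_add_one {a x : ℝ} (h : a ≤ x) (h' : x ≤ a + 1) :
    ⌊x⌋ = ⌊a⌋ ∨ ⌊x⌋ = ⌊a⌋ + 1 := by
  have h1 := Int.floor_mono h
  have h2 := Int.floor_mono h'
  rw [Int.floor_add_one] at h2
  omega

/-- If `x` lies in the unit cell of `b`, lower intervals starting in that cell still reach up to
`x`; if `x` lies in the next cell, higher ones start below it. -/
theorem mem_interval_monotone {b x : ℝ} (h : b ≤ x) (h' : x ≤ b + 1) :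
    (∀ c : ℝ, ⌊c⌋ = ⌊b⌋ → c ≤ b → c ≤ x ∧ x ≤ c + 1) ∨
      (∀ c : ℝ, ⌊c⌋ = ⌊b⌋ → b ≤ c → c ≤ x ∧ x ≤ c + 1) := by
  rcases floor_eq_or_eq_add_one h h' with e | e
  · refine Or.inl fun c hc hcb => ⟨hcb.trans h, ?_⟩
    have h1 := Int.lt_floor_add_one x
    have h2 := Int.floor_le c
    rw [e, ← hc] at h1
    linarith
  · refine Or.inr fun c hc hcb => ⟨?_, by linarith⟩
    have h1 := Int.lt_floor_add_one c
    have h2 := Int.floor_le x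
    rw [e, ← hc] at h2
    push_cast at h2
    linarith

/-- A past interval containing `x` starts in the unit cell of `x`, for otherwise `x ≤ a + 1` would
give `x` the smaller or equal fractional part. The tie rule counts the left end `x = a` as past and
excludes the right end `x = a + 1`. -/
theorem mem_interval_of_before {a x : ℝ} (h : a ≤ x) (h' : x ≤ a + 1)
    (hb : Int.fract a < Int.fract x ∨ (Int.fract a = Int.fract x ∧ x ≤ a)) {c : ℝ}
    (hc : ⌊c⌋ = ⌊a⌋) (hcb : Int.fract c ≤ Int.fract x) : c ≤ x ∧ x ≤ c + 1 := by
  have e : ⌊x⌋ = ⌊a⌋ := by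
    rcases floor_eq_or_eq_add_one h h' with e | e
    · exact e
    · rcases hb with hb | ⟨-, hb⟩
      · have h1 := Int.floor_add_fract a
        have h2 := Int.floor_add_fract x
        rw [e] at h2
        push_cast at h2
        linarith
      · rw [le_antisymm hb h]
  have h1 := Int.floor_add_fract c
  have h2 := Int.floor_add_fract x
  have h3 := Int.fract_lt_one x
  have h4 := Int.fract_nonneg c
  rw [hc, ← e] at h1
  constructor <;> linarith

/-- A future interval containing `x` starts in the cell to the left of `x`: within one cell, `a ≤ x`
would make it past. -/
theorem mem_interval_of_not_before {a x : ℝ} (h : a ≤ x) (h' : x ≤ a + 1)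
    (hb : ¬ (Int.fract a < Int.fract x ∨ (Int.fract a = Int.fract x ∧ x ≤ a))) {c : ℝ}
    (hc : ⌊c⌋ = ⌊a⌋) (hcb : Int.fract x ≤ Int.fract c) : c ≤ x ∧ x ≤ c + 1 := by
  have e : ⌊x⌋ = ⌊a⌋ + 1 := by
    rcases floor_eq_or_eq_add_one h h' with e | e
    · exfalso
      have h1 := Int.floor_add_fract a
      have h2 := Int.floor_add_fract x
      rw [e] at h2
      refine hb ?_
      rcases h.lt_or_eq with h3 | h3
      · exact Or.inl (by linarith)
      · exact Or.inr ⟨by rw [h3], h3.ge⟩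
    · exact e
  have h1 := Int.floor_add_fract c
  have h2 := Int.floor_add_fract x
  have h3 := Int.fract_lt_one c
  have h4 := Int.fract_nonneg x
  rw [e, ← hc] at h2
  push_cast at h2
  constructor <;> linarith

/-- The class of a square is the grid cell of its corner relative to the first point. Every square
of `S` contains a point, which confines the cell to `2 * K + 2` values in each direction and makes
the computed offsets genuine fractional parts. -/
theorem exists_compatible_sequence_covers {K : ℕ} {X : ℕ → ℕ → ℝ} {n m : ℕ} {S : Finset ℕ}
    (hx : ∀ q < n, |X 0 q - X 0 0| ≤ K) (hy : ∀ q < n, |X 1 q - X 1 0| ≤ K)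
    (hSm : S ⊆ Finset.range m) (hS : ∀ j ∈ S, ∃ q < n, Covers X j q) :
    ∃ W : ℕ → Finset ℕ, (∀ r, W r ⊆ S ∧ (W r).card ≤ 8 * (2 * K + 2) ^ 2) ∧
      (∀ r, Compatible (Covers X) (cutIndex K X m) n (r + 1) (W r) (W (r + 1))) ∧
      ∀ q < n, min (depth (Covers X) S q) 2 =
        min (depth (Covers X) (W (cutIndex K X m q)) q) 2 := by
  have hSx : ∀ j ∈ S, -(K + 1 : ℝ) ≤ X 2 j - X 0 0 ∧ X 2 j - X 0 0 ≤ K := by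
    intro j hj
    obtain ⟨q, hq, ⟨h1, h2⟩, -⟩ := hS j hj
    have := abs_le.1 (hx q hq)
    constructor <;> linarith
  have hSy : ∀ j ∈ S, -(K + 1 : ℝ) ≤ X 3 j - X 1 0 ∧ X 3 j - X 1 0 ≤ K := by
    intro j hj
    obtain ⟨q, hq, -, h1, h2⟩ := hS j hj
    have := abs_le.1 (hy q hq)
    constructor <;> linarith
  have hoS : ∀ j ∈ S, offset K (X 2 j - X 0 0) = Int.fract (X 2 j - X 0 0) := fun j hj =>
    offset_eq_fract (hSx j hj).1 (by linarith [(hSx j hj).2])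
  have hoP : ∀ q < n, offset K (X 0 q - X 0 0) = Int.fract (X 0 q - X 0 0) := fun q hq => by
    have := abs_le.1 (hx q hq)
    exact offset_eq_fract (by linarith) (by linarith)
  have hbefore : ∀ q < n, ∀ j ∈ S, (rank K X m j < cutIndex K X m q ↔
      (Int.fract (X 2 j - X 0 0) < Int.fract (X 0 q - X 0 0) ∨
        (Int.fract (X 2 j - X 0 0) = Int.fract (X 0 q - X 0 0) ∧
          X 0 q - X 0 0 ≤ X 2 j - X 0 0))) := by
    intro q hq j hj
    rw [rank_lt_cutIndex (Finset.mem_range.1 (hSm hj)), Before, hoS j hj, hoP q hq,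
      sub_le_sub_iff_right]
  have hfl : ∀ a : ℝ, -(K + 1 : ℝ) ≤ a → a ≤ K → ⌊a⌋ ∈ Finset.Icc (-(K + 1 : ℤ)) K := by
    intro a h1 h2
    rw [Finset.mem_Icc, Int.le_floor]
    exact ⟨by push_cast; linarith, by simpa using Int.floor_mono h2⟩
  have hcard : ((Finset.Icc (-(K + 1 : ℤ)) K) ×ˢ (Finset.Icc (-(K + 1 : ℤ)) K)).card =
      (2 * K + 2) ^ 2 := by
    rw [Finset.card_product, Int.card_Icc, sq]
    congr 1 <;> omega
  rw [← hcard]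
  refine exists_compatible_sequence (cl := fun j => (⌊X 2 j - X 0 0⌋, ⌊X 3 j - X 1 0⌋))
    (y := fun j => X 3 j) (ρ := rank K X m)
    (fun j hj => Finset.mem_product.2 ⟨hfl _ (hSx j hj).1 (hSx j hj).2,
      hfl _ (hSy j hj).1 (hSy j hj).2⟩) ?_ ?_
  · rintro q hq j hj ⟨⟨h1, h2⟩, h3, h4⟩ hρ
    have hxc : ∀ i ∈ S, rank K X m i < cutIndex K X m q → ⌊X 2 i - X 0 0⌋ = ⌊X 2 j - X 0 0⌋ →
        X 2 i ≤ X 0 q ∧ X 0 q ≤ X 2 i + 1 := by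
      intro i hi hρi hcl
      have := mem_interval_of_before (a := X 2 j - X 0 0) (x := X 0 q - X 0 0) (by linarith)
        (by linarith) ((hbefore q hq j hj).1 hρ) hcl
        (((hbefore q hq i hi).1 hρi).elim le_of_lt fun h => h.1.le)
      constructor <;> linarith [this.1, this.2]
    refine (mem_interval_monotone (b := X 3 j - X 1 0) (x := X 1 q - X 1 0) (by linarith)
      (by linarith)).imp ?_ ?_ <;>
    · intro h i hi hρi hcl hle
      rw [Prod.ext_iff] at hcl
      have := h (X 3 i - X 1 0) hcl.2 (by linarith)
      exact ⟨hxc i hi hρi hcl.1, by linarith, by linarith⟩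
  · rintro q hq j hj ⟨⟨h1, h2⟩, h3, h4⟩ hρ
    have hxc : ∀ i ∈ S, cutIndex K X m q ≤ rank K X m i → ⌊X 2 i - X 0 0⌋ = ⌊X 2 j - X 0 0⌋ →
        X 2 i ≤ X 0 q ∧ X 0 q ≤ X 2 i + 1 := by
      intro i hi hρi hcl
      have hi' := (not_congr (hbefore q hq i hi)).1 (not_lt.2 hρi)
      have := mem_interval_of_not_before (a := X 2 j - X 0 0) (x := X 0 q - X 0 0) (by linarith)
        (by linarith) ((not_congr (hbefore q hq j hj)).1 (not_lt.2 hρ)) hcl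
        (not_lt.1 (not_or.1 hi').1)
      constructor <;> linarith [this.1, this.2]
    refine (mem_interval_monotone (b := X 3 j - X 1 0) (x := X 1 q - X 1 0) (by linarith)
      (by linarith)).imp ?_ ?_ <;>
    · intro h i hi hρi hcl hle
      rw [Prod.ext_iff] at hcl
      have := h (X 3 i - X 1 0) hcl.2 (by linarith)
      exact ⟨hxc i hi hρi hcl.1, by linarith, by linarith⟩

end Geometry


/-! ### Optimal sequences by dynamic programming -/

section DynamicProgram

/-- The number of points among `0, …, n - 1` that are incident to exactly one member of `S`. -/
noncomputable def uniqueDepthCount (cov : ℕ → ℕ → Prop) (n : ℕ) (S : Finset ℕ) : ℕ :=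
  ((Finset.range n).filter fun q => depth cov S q = 1).card

/-- A layered acyclic network; every node carries a collection of squares. -/
structure Network where
  n : ℕ
  m : ℕ
  cov : ℕ → ℕ → Prop
  cut : ℕ → ℕ
  sets : ℕ → Finset ℕ
  layer : ℕ → ℕ

namespace Network

variable (G : Network)

/-- The collection of the node covers the points whose cut is the layer of the node. -/
def Valid (s : ℕ) : Prop := ∀ q < G.n, G.cut q = G.layer s → 1 ≤ depth G.cov (G.sets s) q

/-- The number of points whose cut is the layer of the node and which are incident to exactly one
member of its collection. -/
noncomputable def value (s : ℕ) : ℕ :=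
  ((Finset.range G.n).filter fun q =>
    G.cut q = G.layer s ∧ depth G.cov (G.sets s) q = 1).card

def Edge (t s : ℕ) : Prop :=
  G.layer t + 1 = G.layer s ∧ Compatible G.cov G.cut G.n (G.layer s) (G.sets t) (G.sets s)

/-- The entries at `s` of the tables `best` (`0` if no path from layer `0` ends at `s`, otherwise one
more than the largest value of such a path) and `prev` (the last node but one of an optimal path) are
consistent with the entries before. -/
structure TableAt (best prev : ℕ → ℕ) (s : ℕ) : Prop where
  attained : best s ≠ 0 → G.Valid s ∧ ((G.layer s = 0 ∧ best s = G.value s + 1) ∨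
    (prev s < s ∧ G.Edge (prev s) s ∧ best (prev s) ≠ 0 ∧ best s = best (prev s) + G.value s))
  start_le : G.Valid s → G.layer s = 0 → G.value s + 1 ≤ best s
  step_le : G.Valid s → ∀ t < s, G.Edge t s → best t ≠ 0 → best t + G.value s ≤ best s

/-- `f` is a path through the layers `0, …, l`. -/
structure IsPath (f : ℕ → ℕ) (l : ℕ) : Prop where
  layer_eq : ∀ i ≤ l, G.layer (f i) = i
  valid : ∀ i ≤ l, G.Valid (f i)
  edge : ∀ i < l, G.Edge (f i) (f (i + 1))

variable {G} {best prev : ℕ → ℕ} {N : ℕ}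

/-- Soundness of the tables: a nonzero entry is realised by the path found by following `prev` back
to layer `0`. The extra one in `best` stems from the start of the path. -/
theorem isPath_of_table (h : ∀ s < N, G.TableAt best prev s) {l s : ℕ} (hs : s < N)
    (hl : G.layer s = l) (hb : best s ≠ 0) :
    G.IsPath (fun i => prev^[l - i] s) l ∧
      best s = ∑ i ∈ Finset.range (l + 1), G.value (prev^[l - i] s) + 1 := by
  induction l generalizing s with
  | zero =>
    obtain ⟨hv, ⟨-, hb'⟩ | ⟨-, ⟨he, -⟩, -⟩⟩ := (h s hs).attained hb
    · refine ⟨⟨?_, ?_, ?_⟩, ?_⟩ <;> simp_all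
    · omega
  | succ l ih =>
    obtain ⟨hv, ⟨h0, -⟩ | ⟨hlt, he, hb', hsum⟩⟩ := (h s hs).attained hb
    · omega
    obtain ⟨hp, hps⟩ := ih (hlt.trans hs) (by have := he.1; omega) hb'
    have hit : ∀ i ≤ l, prev^[l + 1 - i] s = prev^[l - i] (prev s) := by
      intro i hi
      rw [Nat.sub_add_comm hi, Function.iterate_succ_apply]
    refine ⟨⟨?_, ?_, ?_⟩, ?_⟩
    · intro i hi
      rcases Nat.of_le_succ hi with hi | rfl
      · rw [hit i hi]; exact hp.layer_eq i hi
      · simpa using hl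
    · intro i hi
      rcases Nat.of_le_succ hi with hi | rfl
      · simp only [hit i hi]; exact hp.valid i hi
      · simpa using hv
    · intro i hi
      simp only [hit i (Nat.lt_succ_iff.1 hi)]
      rcases Nat.of_le_succ (Nat.succ_le_of_lt hi) with hi | hi
      · rw [hit (i + 1) hi]; exact hp.edge i hi
      · have : i = l := by omega
        subst this
        simpa using he
    · rw [Finset.sum_range_succ, Finset.sum_congr rfl fun i hi => by
        rw [hit i (Nat.lt_succ_iff.1 (Finset.mem_range.1 hi))], hsum, hps]
      simp
      omega

/-- Completeness of the tables. Node numbers must increase along the path because an entry takes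
only smaller predecessors into account. -/
theorem IsPath.sum_le (h : ∀ s < N, G.TableAt best prev s) {f : ℕ → ℕ} {l : ℕ}
    (hf : G.IsPath f l) (hN : ∀ i ≤ l, f i < N) (hmono : ∀ i < l, f i < f (i + 1)) :
    ∑ i ∈ Finset.range (l + 1), G.value (f i) + 1 ≤ best (f l) := by
  induction l with
  | zero =>
    simpa using (h _ (hN 0 le_rfl)).start_le (hf.valid 0 le_rfl) (hf.layer_eq 0 le_rfl)
  | succ l ih =>
    have h1 := ih ⟨fun i hi => hf.layer_eq i (by omega), fun i hi => hf.valid i (by omega),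
      fun i hi => hf.edge i (by omega)⟩ (fun i hi => hN i (by omega))
      fun i hi => hmono i (by omega)
    have h2 := (h _ (hN (l + 1) le_rfl)).step_le (hf.valid _ le_rfl) (f l) (hmono l (by omega))
      (hf.edge l (by omega)) (by omega)
    rw [Finset.sum_range_succ]
    omega

/-- Being covered exactly once can be read off from the depth capped at two, so each point may be
counted at its own position. -/
theorem uniqueDepthCount_eq_sum {cov : ℕ → ℕ → Prop} {cut : ℕ → ℕ} {n m : ℕ} {W : ℕ → Finset ℕ}
    {S : Finset ℕ} (hcut : ∀ q < n, cut q ≤ m)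
    (h : ∀ q < n, min (depth cov S q) 2 = min (depth cov (W (cut q)) q) 2) :
    uniqueDepthCount cov n S = ∑ i ∈ Finset.range (m + 1),
      ((Finset.range n).filter fun q => cut q = i ∧ depth cov (W i) q = 1).card := by
  rw [uniqueDepthCount, Finset.card_eq_sum_card_fiberwise (f := cut) (t := Finset.range (m + 1))]
  · refine Finset.sum_congr rfl fun i _ => ?_
    rw [Finset.filter_filter]
    congr 1
    refine Finset.filter_congr fun q hq => ?_
    have := h q (Finset.mem_range.1 hq)
    constructor
    · rintro ⟨h1, rfl⟩; exact ⟨rfl, by omega⟩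
    · rintro ⟨rfl, h1⟩; exact ⟨by omega, rfl⟩
  · intro q hq
    have := hcut q (Finset.mem_range.1 (Finset.mem_filter.1 hq).1)
    simp; omega

variable (G) in
/-- The union of the collections along the `prev`-path from layer `m` that ends in `s`. -/
noncomputable def traceSet (prev : ℕ → ℕ) (s : ℕ) : Finset ℕ :=
  (Finset.range (G.m + 1)).biUnion fun i => G.sets (prev^[i] s)

theorem traceSet_spec (hcut : ∀ q < G.n, G.cut q ≤ G.m) (h : ∀ s < N, G.TableAt best prev s)
    {s : ℕ} (hs : s < N) (hl : G.layer s = G.m) (hb : best s ≠ 0) :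
    (∀ q < G.n, 1 ≤ depth G.cov (G.traceSet prev s) q) ∧
      best s = uniqueDepthCount G.cov G.n (G.traceSet prev s) + 1 := by
  obtain ⟨hp, hsum⟩ := isPath_of_table h hs hl hb
  -- The trace runs backwards from layer `m`; reversing the index turns it into a sequence indexed
  -- by layers.
  have htr : G.traceSet prev s =
      (Finset.range (G.m + 1)).biUnion fun i => G.sets (prev^[G.m - i] s) := by
    ext j
    simp only [traceSet, Finset.mem_biUnion, Finset.mem_range]
    constructor <;> rintro ⟨i, hi, hj⟩ <;> refine ⟨G.m - i, by omega, ?_⟩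
    · rwa [Nat.sub_sub_self (by omega)]
    · exact hj
  have hmin : ∀ q < G.n, min (depth G.cov (G.traceSet prev s) q) 2 =
      min (depth G.cov (G.sets (prev^[G.m - G.cut q] s)) q) 2 := by
    intro q hq
    rw [htr]
    refine min_depth_biUnion (W := fun i => G.sets (prev^[G.m - i] s)) (fun i hi => ?_) hq
      (hcut q hq)
    have := (hp.edge i hi).2
    rwa [hp.layer_eq (i + 1) hi] at this
  refine ⟨fun q hq => ?_, ?_⟩
  · have h1 := hmin q hq
    have h2 := hp.valid _ (hcut q hq) q hq (hp.layer_eq _ (hcut q hq)).symm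
    omega
  · rw [hsum, uniqueDepthCount_eq_sum (W := fun i => G.sets (prev^[G.m - i] s)) hcut hmin]
    congr 1
    refine Finset.sum_congr rfl fun i hi => ?_
    have hlayer := hp.layer_eq i (by simpa [Nat.lt_succ_iff] using hi)
    rw [value, hlayer]

/-- A cover that is represented by a compatible sequence is accounted for in the last layer. -/
theorem exists_best_ge (hcut : ∀ q < G.n, G.cut q ≤ G.m) (h : ∀ s < N, G.TableAt best prev s)
    {S : Finset ℕ} {f : ℕ → ℕ} (hN : ∀ i ≤ G.m, f i < N) (hmono : ∀ i < G.m, f i < f (i + 1))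
    (hlayer : ∀ i ≤ G.m, G.layer (f i) = i)
    (hcomp : ∀ i < G.m, Compatible G.cov G.cut G.n (i + 1) (G.sets (f i)) (G.sets (f (i + 1))))
    (hmin : ∀ q < G.n, min (depth G.cov S q) 2 = min (depth G.cov (G.sets (f (G.cut q))) q) 2)
    (hS : ∀ q < G.n, 1 ≤ depth G.cov S q) :
    uniqueDepthCount G.cov G.n S + 1 ≤ best (f G.m) := by
  have hp : G.IsPath f G.m := by
    refine ⟨hlayer, fun i hi q hq he => ?_, fun i hi => ?_⟩
    · rw [hlayer i hi] at he
      have h1 := hmin q hq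
      have h2 := hS q hq
      rw [he] at h1
      omega
    · refine ⟨?_, ?_⟩
      · rw [hlayer i hi.le, hlayer (i + 1) hi]
      · rw [hlayer (i + 1) hi]; exact hcomp i hi
  refine le_trans ?_ (hp.sum_le h hN hmono)
  rw [uniqueDepthCount_eq_sum (W := fun i => G.sets (f i)) hcut hmin]
  refine Nat.add_le_add_right (Finset.sum_le_sum fun i hi => le_of_eq ?_) 1
  rw [value, hlayer i (by simpa [Nat.lt_succ_iff] using hi)]

end Network

/-! ### Numbering small collections -/

/-- The set of the last `L` digits of `s` in base `B`. -/
def digitSet (B : ℕ) : ℕ → ℕ → Finset ℕ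
  | 0, _ => ∅
  | L + 1, s => insert (s % B) (digitSet B L (s / B))

/-- Node `s` stands for the set of the last `L` digits of `s` in base `m + 1`, except the digit `m`. -/
def nodeSet (m L s : ℕ) : Finset ℕ := (digitSet (m + 1) L s).filter (· < m)

/-- The digit `m` is a blank that pads collections with fewer than `L` members. The digits above the
last `L` are free to hold the layer. -/
theorem exists_nodeSet_eq {m L : ℕ} {W : Finset ℕ} (hW : W ⊆ Finset.range m) (hL : W.card ≤ L)
    (r : ℕ) : ∃ s, nodeSet m L s = W ∧ s / (m + 1) ^ L = r := by
  induction L generalizing W with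
  | zero =>
    have : W = ∅ := by simpa using hL
    exact ⟨r, by simp [nodeSet, digitSet, this], by simp⟩
  | succ L ih =>
    have hdig : ∀ a ≤ m, ∀ s, (a + (m + 1) * s) % (m + 1) = a ∧ (a + (m + 1) * s) / (m + 1) = s := by
      intro a ha s
      rw [Nat.add_mul_mod_self_left, Nat.add_mul_div_left _ _ (Nat.succ_pos m),
        Nat.mod_eq_of_lt (by omega), Nat.div_eq_of_lt (by omega)]
      simp
    rcases W.eq_empty_or_nonempty with rfl | ⟨a, ha⟩
    · obtain ⟨s, hs, hr⟩ := ih (W := ∅) (by simp) (by simp)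
      refine ⟨m + (m + 1) * s, ?_, ?_⟩
      · rw [nodeSet, digitSet, (hdig m le_rfl s).1, (hdig m le_rfl s).2, Finset.filter_insert,
          if_neg (lt_irrefl m)]
        exact hs
      · rw [pow_succ', ← Nat.div_div_eq_div_mul, (hdig m le_rfl s).2, hr]
    · have ham : a < m := Finset.mem_range.1 (hW ha)
      obtain ⟨s, hs, hr⟩ := ih (W := W.erase a) ((Finset.erase_subset _ _).trans hW)
        (by rw [Finset.card_erase_of_mem ha]; omega)
      refine ⟨a + (m + 1) * s, ?_, ?_⟩
      · rw [nodeSet, digitSet, (hdig a ham.le s).1, (hdig a ham.le s).2, Finset.filter_insert,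
          if_pos ham]
        rw [nodeSet] at hs
        rw [hs, Finset.insert_erase ha]
      · rw [pow_succ', ← Nat.div_div_eq_div_mul, (hdig a ham.le s).2, hr]

/-- The network of the sweep over an instance with `n` points and `m` squares. -/
noncomputable def sweepNetwork (K L n m : ℕ) (X : ℕ → ℕ → ℝ) : Network where
  n := n
  m := m
  cov := Covers X
  cut := cutIndex K X m
  sets := nodeSet m L
  layer s := s / (m + 1) ^ L

theorem exists_best_ge_of_cover {K L n m : ℕ} {X : ℕ → ℕ → ℝ} (hL : 8 * (2 * K + 2) ^ 2 ≤ L)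
    (hx : ∀ q < n, |X 0 q - X 0 0| ≤ K) (hy : ∀ q < n, |X 1 q - X 1 0| ≤ K)
    {best prev : ℕ → ℕ}
    (h : ∀ s < (m + 1) ^ (L + 1), (sweepNetwork K L n m X).TableAt best prev s)
    {S : Finset ℕ} (hSm : S ⊆ Finset.range m) (hS : ∀ q < n, 1 ≤ depth (Covers X) S q) :
    ∃ s < (m + 1) ^ (L + 1), (sweepNetwork K L n m X).layer s = m ∧
      uniqueDepthCount (Covers X) n S + 1 ≤ best s := by
  classical
  -- Squares without points change no depth at a point, but their corners could lie outside the
  -- range in which offsets and classes are controlled.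
  set S' := S.filter fun j => ∃ q < n, Covers X j q with hS'
  have hdepth : ∀ q < n, depth (Covers X) S' q = depth (Covers X) S q := by
    intro q hq
    refine le_antisymm (depth_mono fun j hj _ => (Finset.mem_filter.1 hj).1)
      (depth_mono fun j hj hc => Finset.mem_filter.2 ⟨hj, q, hq, hc⟩)
  have huniq : uniqueDepthCount (Covers X) n S = uniqueDepthCount (Covers X) n S' := by
    unfold uniqueDepthCount
    congr 1
    refine Finset.filter_congr fun q hq => ?_
    rw [hdepth q (Finset.mem_range.1 hq)]
  obtain ⟨W, hW, hcomp, hmin⟩ := exists_compatible_sequence_covers hx hy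
    ((Finset.filter_subset _ _).trans hSm) fun j hj => (Finset.mem_filter.1 hj).2
  have hWm : ∀ r, W r ⊆ Finset.range m := fun r =>
    (hW r).1.trans ((Finset.filter_subset _ _).trans hSm)
  choose f hf hfl using fun r => exists_nodeSet_eq (hWm r) ((hW r).2.trans hL) r
  have hpos : 0 < (m + 1) ^ L := by positivity
  have hN : ∀ i ≤ m, f i < (m + 1) ^ (L + 1) := by
    intro i hi
    rw [pow_succ', ← Nat.div_lt_iff_lt_mul hpos, hfl]
    omega
  refine ⟨f m, hN m le_rfl, hfl m, ?_⟩
  rw [huniq]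
  refine Network.exists_best_ge (G := sweepNetwork K L n m X) (f := f)
    (fun q _ => cutIndex_le K X m q) h hN ?_ (fun i _ => hfl i) ?_ ?_ ?_
  -- The layer is the leading part of the node number, so a later layer means a larger number.
  · intro i _
    by_contra hn
    have := Nat.div_le_div_right (c := (m + 1) ^ L) (not_lt.1 hn)
    rw [hfl, hfl] at this
    omega
  · intro i _
    simpa only [sweepNetwork, hf] using hcomp i
  · intro q hq
    simpa only [sweepNetwork, hf] using hmin q hq
  · intro q hq
    simpa only [sweepNetwork, hdepth q hq] using hS q hq

end DynamicProgram


/-! ### Building blocks of the program -/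

section Blocks

theorem Frame.seq_left {p q : Program} {σ τ : State} (h : Frame p σ τ) :
    Frame (.seq p q) σ τ := by
  refine h.mono ?_ ?_ ?_ ?_ <;>
    simp +contextual [Program.writesNat, Program.writesNatArr, Program.writesReal,
      Program.writesRealArr]

theorem Frame.seq_right {p q : Program} {σ τ : State} (h : Frame q σ τ) :
    Frame (.seq p q) σ τ := by
  refine h.mono ?_ ?_ ?_ ?_ <;>
    simp +contextual [Program.writesNat, Program.writesNatArr, Program.writesReal,
      Program.writesRealArr]

theorem frame_setNat (x : ℕ) (e : NatExpr) (σ : State) (v : ℕ) :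
    Frame (.setNat x e) σ (σ.setNat x v) := by
  constructor <;> simp +contextual [Program.writesNat]

/-- The program does not assign to the input. -/
abbrev KeepsInput (p : Program) : Prop :=
  (p.writesNat 0 = false ∧ p.writesNat 1 = false) ∧
    (p.writesRealArr 0 = false ∧ p.writesRealArr 1 = false) ∧
    p.writesRealArr 2 = false ∧ p.writesRealArr 3 = false

/-- The state contains an instance with `n` points, `m` squares and the coordinates `X`. -/
structure HasInput (n m : ℕ) (X : ℕ → ℕ → ℝ) (σ : State) : Prop where
  n_eq : σ.natVar 0 = n
  m_eq : σ.natVar 1 = m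
  row0 : σ.realArr 0 = X 0
  row1 : σ.realArr 1 = X 1
  row2 : σ.realArr 2 = X 2
  row3 : σ.realArr 3 = X 3

theorem HasInput.frame {n m : ℕ} {X : ℕ → ℕ → ℝ} {σ τ : State} {p : Program}
    (h : HasInput n m X σ) (hp : KeepsInput p) (hF : Frame p σ τ) : HasInput n m X τ :=
  ⟨(hF.natVar 0 hp.1.1).trans h.n_eq, (hF.natVar 1 hp.1.2).trans h.m_eq,
   (hF.realArr 0 hp.2.1.1).trans h.row0, (hF.realArr 1 hp.2.1.2).trans h.row1,
   (hF.realArr 2 hp.2.2.1).trans h.row2, (hF.realArr 3 hp.2.2.2).trans h.row3⟩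

theorem HasInput.setNat {n m : ℕ} {X : ℕ → ℕ → ℝ} {σ : State} {x v : ℕ}
    (h : HasInput n m X σ) (hx : 2 ≤ x) : HasInput n m X (σ.setNat x v) :=
  ⟨by rw [State.setNat_natVar, if_neg (by omega)]; exact h.n_eq,
   by rw [State.setNat_natVar, if_neg (by omega)]; exact h.m_eq, h.row0, h.row1, h.row2, h.row3⟩

/-- The natural array `a` contains the indicator function of `W`. -/
def Represents (m a : ℕ) (σ : State) (W : Finset ℕ) : Prop :=
  ∀ j < m, (1 ≤ σ.natArr a j ↔ j ∈ W)

theorem Represents.congr {m a : ℕ} {σ τ : State} {W : Finset ℕ} (h : Represents m a σ W)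
    (hστ : τ.natArr a = σ.natArr a) : Represents m a τ W := by
  intro j hj
  rw [hστ]
  exact h j hj

theorem card_filter_range_succ (pr : ℕ → Prop) [DecidablePred pr] (i : ℕ) :
    ((Finset.range (i + 1)).filter pr).card =
      ((Finset.range i).filter pr).card + if pr i then 1 else 0 := by
  rw [Finset.range_add_one, Finset.filter_insert]
  split_ifs
  · rw [Finset.card_insert_of_notMem (by simp)]
  · rfl

theorem forall_lt_succ_iff {pr : ℕ → Prop} {i : ℕ} :
    (∀ q < i + 1, pr q) ↔ (∀ q < i, pr q) ∧ pr i := by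
  simp only [Nat.lt_succ_iff_lt_or_eq, or_imp, forall_and, forall_eq]

/-! #### Tests -/

def natEq (e f : NatExpr) : BoolExpr := .and (.natLe e f) (.natLe f e)

def natLt (e f : NatExpr) : BoolExpr := .natLe (.add e (.const 1)) f

def boolOr (b c : BoolExpr) : BoolExpr := .not (.and (.not b) (.not c))

@[simp] theorem holds_natEq {e f : NatExpr} {σ : State} :
    (natEq e f).Holds σ ↔ e.eval σ = f.eval σ := by
  simp only [natEq, BoolExpr.Holds]; omega

@[simp] theorem holds_natLt {e f : NatExpr} {σ : State} :
    (natLt e f).Holds σ ↔ e.eval σ < f.eval σ := Iff.rfl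

@[simp] theorem holds_boolOr {b c : BoolExpr} {σ : State} :
    (boolOr b c).Holds σ ↔ b.Holds σ ∨ c.Holds σ := by
  simp only [boolOr, BoolExpr.Holds]; tauto

/-- Entry `j` of the natural array `a` is positive, where `j` is the natural variable `5`. -/
def memTest (a : ℕ) : BoolExpr := .natLe (.const 1) (.get a (.var 5))

/-- Square `j` contains point `q`, where `j` and `q` are the natural variables `5` and `4`. -/
def coverTest : BoolExpr :=
  .and (.and (.realLe (.get 2 (.var 5)) (.get 0 (.var 4)))
      (.realLe (.get 0 (.var 4)) (.add (.get 2 (.var 5)) (.const 1))))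
    (.and (.realLe (.get 3 (.var 5)) (.get 1 (.var 4)))
      (.realLe (.get 1 (.var 4)) (.add (.get 3 (.var 5)) (.const 1))))

theorem holds_coverTest {n m : ℕ} {X : ℕ → ℕ → ℝ} {σ : State} (h : HasInput n m X σ) :
    coverTest.Holds σ ↔ Covers X (σ.natVar 5) (σ.natVar 4) := by
  simp [coverTest, BoolExpr.Holds, RealExpr.eval, NatExpr.eval, Covers, h.row0, h.row1, h.row2,
    h.row3]

/-! #### Counting squares -/

/-- Count in the natural variable `out` the squares that satisfy `b`. -/
def countIf (out : ℕ) (b : BoolExpr) : Program :=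
  .seq (.setNat out (.const 0))
    (forLoop 5 (.var 1) (.cond b (.setNat out (.add (.var out) (.const 1))) .skip))

open Classical in
theorem countIf_spec {out m Y : ℕ} {b : BoolExpr} {σ : State} {pr : ℕ → Prop} (h1 : out ≠ 1)
    (h5 : out ≠ 5) (hm : σ.natVar 1 = m) (hmY : m ≤ Y) (hY : 1 ≤ Y)
    (hb : ∀ j < m, ∀ τ, Frame (countIf out b) σ τ → τ.natVar 5 = j → (b.Holds τ ↔ pr j)) :
    Within (countIf out b) (Y * (b.cost + 30)) σ fun τ =>
      τ.natVar out = ((Finset.range m).filter pr).card := by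
  refine Within.time_mono (Within.seq (U := Y * (1 + b.cost + (4 + 1) + 16 + 2 * 1))
    (Within.setNat ?_)) ?_
  · refine Within.forLoop (b := m) (fun i τ => τ.natVar out = ((Finset.range i).filter pr).card)
      ?_ hmY hY ?_ ?_ ?_
    · simp [Program.writesNat, h5.symm]
    · intro τ hF
      have := hF.natVar 1 (by simp [forLoop, Program.writesNat, h1.symm])
      simpa [NatExpr.eval, h1.symm, hm] using this
    · simp [h5, NatExpr.eval]
    · intro i τ hi hF h5i hI
      have hiff := hb i hi τ ((frame_setNat out (.const 0) σ _).seq_left.trans hF.seq_right) h5i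
      refine Within.cond (fun h => Within.setNat ?_) (fun h => Within.skip ?_)
      · simp only [NatExpr.eval, State.setNat_natVar, if_neg h5, if_true, hI]
        rw [card_filter_range_succ, if_pos (hiff.1 h)]
      · simp only [State.setNat_natVar, if_neg h5, hI]
        rw [card_filter_range_succ, if_neg (mt hiff.2 h), add_zero]
  · simp only [NatExpr.cost]
    nlinarith

open Classical in
theorem card_filter_range_eq_depth {m : ℕ} {W : Finset ℕ} (hW : W ⊆ Finset.range m)
    {cov : ℕ → ℕ → Prop} {q : ℕ} {pr : ℕ → Prop}
    (hpr : ∀ j, pr j ↔ j ∈ W ∧ cov j q) :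
    ((Finset.range m).filter pr).card = depth cov W q := by
  unfold depth
  congr 1
  ext j
  simp only [Finset.mem_filter, hpr]
  exact ⟨fun h => h.2, fun h => ⟨hW h.1, h⟩⟩

/-! #### Decoding nodes -/

/-- Replace the natural variable `10` by its quotient by `m + 1`, and set the entry of the array `a`
at the remainder to `1`. -/
def digitStep (a : ℕ) : Program :=
  .seq (.setNat 11 (.const 0))
    (.seq (.loop (.natLe (.add (.var 1) (.const 1)) (.var 10))
        (.seq (.setNat 10 (.sub (.var 10) (.add (.var 1) (.const 1))))
          (.setNat 11 (.add (.var 11) (.const 1)))))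
      (.seq (.putNat a (.var 10) (.const 1)) (.setNat 10 (.var 11))))

/-- Division with remainder by repeated subtraction; the loop preserves remainder plus `m + 1` times
quotient. The number of subtractions is at most `s`, whence the factor `Y`. -/
theorem digitStep_spec {a m s Y : ℕ} {σ : State} (hm : σ.natVar 1 = m) (hs : σ.natVar 10 = s)
    (hsY : s < Y) :
    Within (digitStep a) (Y * 40) σ fun τ => τ.natVar 10 = s / (m + 1) ∧
      τ.natArr a = Function.update (σ.natArr a) (s % (m + 1)) 1 := by
  refine Within.time_mono (Within.seq (Within.setNat (Within.seq (U := 5) (Within.imp (Within.loop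
    (T := 10) (fun τ => τ.natVar 1 = m ∧ τ.natVar 10 + (m + 1) * τ.natVar 11 = s ∧
      τ.natArr = σ.natArr)
    (fun τ => τ.natVar 10) ?_ ?_) le_rfl ?_)))) ?_
  · rintro τ ⟨h1, h2, h3⟩ hle
    simp only [BoolExpr.Holds, NatExpr.eval, h1] at hle
    refine Within.time_mono (Within.seq (Within.setNat (Within.setNat ?_))) ?_
    · simp only [NatExpr.eval, State.setNat_natVar, State.setNat_natArr]
      simp [h1, h3]
      have : (m + 1) * (τ.natVar 11 + 1) = (m + 1) * τ.natVar 11 + (m + 1) := by ring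
      omega
    · simp [NatExpr.cost]
  · simp [NatExpr.eval, hm, hs]
  · rintro τ - ⟨⟨h1, h2, h3⟩, hle⟩
    simp only [BoolExpr.Holds, NatExpr.eval, h1] at hle
    refine Within.time_mono (Within.seq (Within.putNat (Within.setNat ?_))) ?_
    · have hd : s / (m + 1) = τ.natVar 11 ∧ s % (m + 1) = τ.natVar 10 := by
        rw [← h2, Nat.add_mul_mod_self_left, Nat.add_mul_div_left _ _ (Nat.succ_pos m),
          Nat.mod_eq_of_lt (by omega), Nat.div_eq_of_lt (by omega)]
        simp
      simp [NatExpr.eval, hd.1, hd.2, h3]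
    · simp [NatExpr.cost]
  · simp [NatExpr.cost, BoolExpr.cost, NatExpr.eval, hs]
    omega

/-- Decode the node in the natural variable `src`: put the indicator function of its collection into
the natural array `a` and its layer into the natural variable `out`. -/
def decode (L src a out : ℕ) : Program :=
  .seq (forLoop 5 (.var 1) (.putNat a (.var 5) (.const 0)))
    (.seq (.setNat 10 (.var src))
      (.seq (forLoop 9 (.const L) (digitStep a)) (.setNat out (.var 10))))

theorem decode_spec {L src a out m s Y : ℕ} {σ : State} (hsrc : src ≠ 5)
    (hm : σ.natVar 1 = m) (hs : σ.natVar src = s) (hsY : s < Y) (hmY : m ≤ Y) :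
    Within (decode L src a out) (Y * ((L + 1) * 90)) σ fun τ =>
      Represents m a τ (nodeSet m L s) ∧ τ.natVar out = s / (m + 1) ^ L := by
  have hY : 1 ≤ Y := by omega
  refine Within.time_mono (Within.seq (U := 2 + ((L + 1) * (Y * 40 + 16 + 2) + 2))
    (Within.imp (Within.forLoop (b := m) (Y := Y) (T := 3)
      (fun i τ => ∀ j < i, τ.natArr a j = 0) ?_ hmY hY ?_ ?_ ?_) le_rfl ?_)) ?_
  · simp [Program.writesNat]
  · intro τ hF
    rw [← hm]
    exact hF.natVar 1 (by simp [forLoop, Program.writesNat])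
  · simp
  · intro i τ hi hF h5 hI
    refine Within.putNat (i := .var 5) (e := .const 0) ?_
    intro j hj
    simp only [NatExpr.eval, h5, State.setNat_natArr, State.putNat_natArr, if_true,
      Function.update_apply]
    split_ifs with h
    · rfl
    · exact hI j (by omega)
  · intro τ hF hz
    have hτ1 : τ.natVar 1 = m := (hF.natVar 1 (by simp [forLoop, Program.writesNat])).trans hm
    have hτs : τ.natVar src = s :=
      (hF.natVar src (by simp [forLoop, Program.writesNat, hsrc])).trans hs
    refine Within.seq (Within.setNat (Within.seq (Within.imp (Within.forLoop (b := L) (Y := L + 1)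
      (T := Y * 40)
      -- The digits already marked together with the digits still to be read make up the whole digit
      -- set.
      (fun i υ => υ.natVar 10 = s / (m + 1) ^ i ∧ ∀ j < m, ((1 ≤ υ.natArr a j ∨
        j ∈ digitSet (m + 1) (L - i) (s / (m + 1) ^ i)) ↔ j ∈ digitSet (m + 1) L s))
      ?_ (Nat.le_succ L) (by omega) ?_ ?_ ?_) le_rfl ?_)))
    · simp [digitStep, Program.writesNat]
    · intro υ _; rfl
    · refine ⟨by simp [NatExpr.eval, hτs], fun j hj => ?_⟩
      simp [hz j hj]
    · rintro i υ hi hF' h9 ⟨hI1, hI2⟩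
      have hυ1 : υ.natVar 1 = m := by
        have := hF'.natVar 1 (by simp [forLoop, digitStep, Program.writesNat])
        simpa [hτ1] using this
      refine (digitStep_spec hυ1 hI1 ((Nat.div_le_self _ _).trans_lt hsY)).imp le_rfl ?_
      rintro χ - ⟨h1, h2⟩
      refine ⟨?_, fun j hj => ?_⟩
      · simp [h1, pow_succ, Nat.div_div_eq_div_mul]
      · rw [← hI2 j hj]
        obtain ⟨l, hl⟩ : ∃ l, L - i = l + 1 := ⟨L - i - 1, by omega⟩
        have hl' : L - (i + 1) = l := by omega
        rw [hl, hl', digitSet, Finset.mem_insert, State.setNat_natArr, h2, pow_succ,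
          ← Nat.div_div_eq_div_mul, Function.update_apply]
        split_ifs with h
        · simp [h]
        · simp [h]
    · rintro υ - ⟨hI1, hI2⟩
      refine Within.setNat (e := .var 10) ?_
      refine ⟨fun j hj => ?_, by simp [NatExpr.eval, hI1]⟩
      have := hI2 j hj
      simp only [Nat.sub_self, digitSet, Finset.notMem_empty, or_false] at this
      -- The blank digit may mark entry `m` of the array; only entries below `m` matter.
      simp [this, nodeSet, hj]
  · simp only [NatExpr.cost]
    have h1 : L + 1 ≤ Y * (L + 1) := Nat.le_mul_of_pos_left _ hY
    have h2 : Y ≤ Y * (L + 1) := Nat.le_mul_of_pos_right _ (by omega)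
    linarith

end Blocks


/-! ### Checking nodes and edges -/

section Checks

theorem countCovering_spec {out n m Y q : ℕ} {X : ℕ → ℕ → ℝ} {b : BoolExpr} {σ : State}
    {W : Finset ℕ} (hout : 6 ≤ out) (hσ : HasInput n m X σ) (hq : σ.natVar 4 = q) (hmY : m ≤ Y)
    (hY : 1 ≤ Y) (hW : W ⊆ Finset.range m) (hcost : b.cost ≤ 12)
    (hb : ∀ j < m, ∀ τ, τ.natArr = σ.natArr → τ.natVar 5 = j → (b.Holds τ ↔ j ∈ W)) :
    Within (countIf out (.and b coverTest)) (Y * 70) σ fun τ =>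
      τ.natVar out = depth (Covers X) W q := by
  classical
  refine (countIf_spec (pr := fun j => j ∈ W ∧ Covers X j q) (by omega) (by omega) hσ.m_eq hmY hY
    ?_).imp ?_ ?_
  · intro j hj τ hF h5
    have hτ : HasInput n m X τ := hσ.frame (by
      simp [KeepsInput, countIf, forLoop, Program.writesNat, Program.writesRealArr]; omega) hF
    have h4 : τ.natVar 4 = q := (hF.natVar 4 (by
      simp [countIf, forLoop, Program.writesNat]; omega)).trans hq
    have hA : τ.natArr = σ.natArr := funext fun a => hF.natArr a (by
      simp [countIf, forLoop, Program.writesNatArr])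
    rw [BoolExpr.Holds, hb j hj τ hA h5, holds_coverTest hτ, h4, h5]
  · refine Nat.mul_le_mul_left _ ?_
    simp [BoolExpr.cost, coverTest, RealExpr.cost, NatExpr.cost]
    omega
  · intro τ _ h
    exact h.trans (card_filter_range_eq_depth hW fun _ => Iff.rfl)

theorem countMembers_spec {out a n m Y q : ℕ} {X : ℕ → ℕ → ℝ} {σ : State}
    {W : Finset ℕ} (hout : 6 ≤ out) (hσ : HasInput n m X σ) (hq : σ.natVar 4 = q) (hmY : m ≤ Y)
    (hY : 1 ≤ Y) (hW : W ⊆ Finset.range m) (hrep : Represents m a σ W) :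
    Within (countIf out (.and (memTest a) coverTest)) (Y * 70) σ fun τ =>
      τ.natVar out = depth (Covers X) W q := by
  refine countCovering_spec hout hσ hq hmY hY hW (by simp [memTest, BoolExpr.cost, NatExpr.cost]) ?_
  intro j hj τ hA h5
  rw [← hrep j hj, memTest, BoolExpr.Holds]
  simp [NatExpr.eval, h5, hA]

theorem countCommon_spec {out a a' n m Y q : ℕ} {X : ℕ → ℕ → ℝ} {σ : State}
    {W W' : Finset ℕ} (hout : 6 ≤ out) (hσ : HasInput n m X σ) (hq : σ.natVar 4 = q) (hmY : m ≤ Y)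
    (hY : 1 ≤ Y) (hW : W ⊆ Finset.range m) (hrep : Represents m a σ W)
    (hrep' : Represents m a' σ W') :
    Within (countIf out (.and (.and (memTest a) (memTest a')) coverTest)) (Y * 70) σ fun τ =>
      τ.natVar out = depth (Covers X) (W ∩ W') q := by
  refine countCovering_spec hout hσ hq hmY hY (Finset.inter_subset_left.trans hW)
    (by simp [memTest, BoolExpr.cost, NatExpr.cost]) ?_
  intro j hj τ hA h5
  rw [Finset.mem_inter, ← hrep j hj, ← hrep' j hj]
  simp [memTest, BoolExpr.Holds, NatExpr.eval, h5, hA]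

/-- For the collection in the natural array `3` and the layer in the natural variable `15`, compute
the validity and the value of the node in the natural variables `16` and `17`. -/
def checkNode : Program :=
  .seq (.setNat 16 (.const 1)) (.seq (.setNat 17 (.const 0))
    (forLoop 4 (.var 0) (.cond (natEq (.get 1 (.var 4)) (.var 15))
      (.seq (countIf 6 (.and (memTest 3) coverTest))
        (.seq (.cond (natEq (.var 6) (.const 0)) (.setNat 16 (.const 0)) .skip)
          (.cond (natEq (.var 6) (.const 1)) (.setNat 17 (.add (.var 17) (.const 1))) .skip)))
      .skip)))

theorem checkNode_spec {n m r Y : ℕ} {X : ℕ → ℕ → ℝ} {cut : ℕ → ℕ} {σ : State} {W : Finset ℕ}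
    (hσ : HasInput n m X σ) (hcut : ∀ q < n, σ.natArr 1 q = cut q) (hr : σ.natVar 15 = r)
    (hW : W ⊆ Finset.range m) (hrep : Represents m 3 σ W) (hmY : m ≤ Y) (hY : 1 ≤ Y) :
    Within checkNode ((n + 1) * (Y * 140)) σ fun τ =>
      (τ.natVar 16 = 1 ↔ ∀ q < n, cut q = r → 1 ≤ depth (Covers X) W q) ∧
      τ.natVar 17 = ((Finset.range n).filter fun q =>
        cut q = r ∧ depth (Covers X) W q = 1).card := by
  refine Within.time_mono (Within.seq (Within.setNat (Within.seq (Within.setNat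
    (Within.forLoop (b := n) (Y := n + 1) (T := Y * 70 + 40) (fun i τ =>
      (τ.natVar 16 = 1 ↔ ∀ q < i, cut q = r → 1 ≤ depth (Covers X) W q) ∧
      τ.natVar 17 = ((Finset.range i).filter fun q =>
        cut q = r ∧ depth (Covers X) W q = 1).card) rfl (Nat.le_succ n) (by omega) ?_ ?_ ?_))))) ?_
  · intro τ hF
    exact (hF.natVar 0 rfl).trans hσ.n_eq
  · simp [NatExpr.eval]
  · rintro i τ hi hF h4 ⟨h16, h17⟩
    have hτ : HasInput n m X τ :=
      ((hσ.setNat (x := 16) (by omega)).setNat (x := 17) (by omega)).frame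
        ⟨⟨rfl, rfl⟩, ⟨rfl, rfl⟩, rfl, rfl⟩ hF
    have hcutτ : τ.natArr 1 i = cut i := by
      rw [hF.natArr 1 rfl]; exact hcut i hi
    have hrτ : τ.natVar 15 = r := (hF.natVar 15 rfl).trans hr
    have hrepτ : Represents m 3 τ W := hrep.congr (hF.natArr 3 rfl)
    refine Within.time_mono (Within.cond (T := Y * 70 + 26) (fun hb => ?_)
      fun hb => Within.skip ?_) ?_
    · have hb' : cut i = r := by
        simpa [NatExpr.eval, h4, hcutτ, hrτ] using hb
      refine Within.time_mono (Within.seq (U := 26) ((countMembers_spec (by omega) hτ h4 hmY hY hW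
        hrepτ).imp le_rfl ?_)) le_rfl
      intro υ hFυ h6
      have e16 : υ.natVar 16 = τ.natVar 16 := hFυ.natVar 16 rfl
      have e17 : υ.natVar 17 = τ.natVar 17 := hFυ.natVar 17 rfl
      rw [card_filter_range_succ, forall_lt_succ_iff]
      refine Within.time_mono (Within.seq (T := 11) (U := 15) (Within.time_mono (Within.cond
        (fun h => Within.setNat (Within.time_mono (Within.cond
          (fun h' => Within.setNat ?_) fun h' => Within.skip ?_) ?_))
        (fun h => Within.skip (Within.time_mono (Within.cond
          (fun h' => Within.setNat ?_) fun h' => Within.skip ?_) ?_))) ?_)) ?_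
      all_goals try simp [natEq, NatExpr.cost, BoolExpr.cost]
      all_goals
        simp [NatExpr.eval, h6] at h h'
        simp [NatExpr.eval, *]
      all_goals omega
    · have hb' : cut i ≠ r := by
        simpa [NatExpr.eval, h4, hcutτ, hrτ] using hb
      rw [card_filter_range_succ, forall_lt_succ_iff]
      simp [hb', h16, h17]
    · simp [natEq, NatExpr.cost, BoolExpr.cost]
      omega
  · simp only [NatExpr.cost]
    nlinarith

end Checks


/-! ### Testing edges, and computing offsets, cuts and the number of nodes -/

section Preparation

/-- Two collections may not follow each other because of point `q`, the natural variable `4`. -/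
def conflictTest : BoolExpr :=
  boolOr
    (.and (.natLe (.var 15) (.get 1 (.var 4)))
      (.and (natLt (.var 8) (.var 6)) (natLt (.var 7) (.const 2))))
    (.and (natLt (.get 1 (.var 4)) (.var 15))
      (.and (natLt (.var 8) (.var 7)) (natLt (.var 6) (.const 2))))

/-- For the collections in the natural arrays `2` and `3` and the layers in the natural variables
`14` and `15`, test in the natural variable `21` whether there is an edge. -/
def checkEdge : Program :=
  .seq (.cond (natEq (.add (.var 14) (.const 1)) (.var 15)) (.setNat 21 (.const 1))
      (.setNat 21 (.const 0)))
    (forLoop 4 (.var 0)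
      (.seq (countIf 6 (.and (memTest 2) coverTest))
        (.seq (countIf 7 (.and (memTest 3) coverTest))
          (.seq (countIf 8 (.and (.and (memTest 2) (memTest 3)) coverTest))
            (.cond conflictTest (.setNat 21 (.const 0)) .skip)))))

theorem checkEdge_spec {n m r r' Y : ℕ} {X : ℕ → ℕ → ℝ} {cut : ℕ → ℕ} {σ : State}
    {A B : Finset ℕ} (hσ : HasInput n m X σ) (hcut : ∀ q < n, σ.natArr 1 q = cut q)
    (hr : σ.natVar 14 = r) (hr' : σ.natVar 15 = r')
    (hA : A ⊆ Finset.range m) (hB : B ⊆ Finset.range m)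
    (hrepA : Represents m 2 σ A) (hrepB : Represents m 3 σ B) (hmY : m ≤ Y) (hY : 1 ≤ Y) :
    Within checkEdge ((n + 1) * (Y * 310)) σ fun τ =>
      (τ.natVar 21 = 1 ↔ r + 1 = r' ∧ Compatible (Covers X) cut n r' A B) := by
  refine Within.time_mono (Within.seq (T := 16) (U := (n + 1) * (Y * 210 + 60 + 16 + 2 * 1))
    (Within.time_mono (Within.imp (Q := fun τ => τ.natVar 21 = 1 ↔ r + 1 = r')
      (Within.cond (fun h => Within.setNat ?_) (fun h => Within.setNat ?_)) le_rfl ?_) ?_)) ?_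
  · simpa [NatExpr.eval, hr, hr'] using h
  · simpa [NatExpr.eval, hr, hr'] using h
  · intro υ hFυ h21
    have hυ : HasInput n m X υ := hσ.frame ⟨⟨rfl, rfl⟩, ⟨rfl, rfl⟩, rfl, rfl⟩ hFυ
    refine Within.forLoop (b := n) (fun i τ => (τ.natVar 21 = 1 ↔ r + 1 = r' ∧
      Compatible (Covers X) cut i r' A B)) rfl (Nat.le_succ n) (by omega) ?_ ?_ ?_
    · intro τ hF
      exact (hF.natVar 0 rfl).trans hυ.n_eq
    · simpa [Compatible] using h21
    · intro i τ hi hF h4 hI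
      have hτ : HasInput n m X τ := hυ.frame ⟨⟨rfl, rfl⟩, ⟨rfl, rfl⟩, rfl, rfl⟩ hF
      have hcutτ : τ.natArr 1 i = cut i := by
        rw [hF.natArr 1 rfl, hFυ.natArr 1 rfl]; exact hcut i hi
      have hrτ : τ.natVar 15 = r' :=
        ((hF.natVar 15 rfl).trans (hFυ.natVar 15 rfl)).trans hr'
      have hAτ : Represents m 2 τ A := (hrepA.congr (hFυ.natArr 2 rfl)).congr (hF.natArr 2 rfl)
      have hBτ : Represents m 3 τ B := (hrepB.congr (hFυ.natArr 3 rfl)).congr (hF.natArr 3 rfl)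
      refine Within.time_mono (Within.seq (U := Y * 70 + (Y * 70 + 60))
        ((countMembers_spec (by omega) hτ h4 hmY hY hA hAτ).imp le_rfl ?_)) (by omega)
      intro τ₁ hF₁ h6
      refine Within.seq ((countMembers_spec (by omega)
        (hτ.frame ⟨⟨rfl, rfl⟩, ⟨rfl, rfl⟩, rfl, rfl⟩ hF₁) ((hF₁.natVar 4 rfl).trans h4) hmY hY hB
        (hBτ.congr (hF₁.natArr 3 rfl))).imp le_rfl ?_)
      intro τ₂ hF₂ h7
      refine Within.seq ((countCommon_spec (by omega)
        ((hτ.frame ⟨⟨rfl, rfl⟩, ⟨rfl, rfl⟩, rfl, rfl⟩ hF₁).frame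
          ⟨⟨rfl, rfl⟩, ⟨rfl, rfl⟩, rfl, rfl⟩ hF₂)
        ((hF₂.natVar 4 rfl).trans ((hF₁.natVar 4 rfl).trans h4)) hmY hY hA
        ((hAτ.congr (hF₁.natArr 2 rfl)).congr (hF₂.natArr 2 rfl))
        ((hBτ.congr (hF₁.natArr 3 rfl)).congr (hF₂.natArr 3 rfl))).imp le_rfl ?_)
      intro τ₃ hF₃ h8
      have e6 : τ₃.natVar 6 = depth (Covers X) A i :=
        ((hF₃.natVar 6 rfl).trans (hF₂.natVar 6 rfl)).trans h6
      have e7 : τ₃.natVar 7 = depth (Covers X) B i := (hF₃.natVar 7 rfl).trans h7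
      have e4 : τ₃.natVar 4 = i :=
        ((hF₃.natVar 4 rfl).trans ((hF₂.natVar 4 rfl).trans (hF₁.natVar 4 rfl))).trans h4
      have e15 : τ₃.natVar 15 = r' :=
        ((hF₃.natVar 15 rfl).trans ((hF₂.natVar 15 rfl).trans (hF₁.natVar 15 rfl))).trans hrτ
      have e21 : τ₃.natVar 21 = τ.natVar 21 :=
        (hF₃.natVar 21 rfl).trans ((hF₂.natVar 21 rfl).trans (hF₁.natVar 21 rfl))
      have ecut : τ₃.natArr 1 i = cut i := by
        rw [hF₃.natArr 1 rfl, hF₂.natArr 1 rfl, hF₁.natArr 1 rfl]; exact hcutτ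
      -- One more point adds the two clauses for that point; their failure is a comparison of the
      -- three computed depths.
      have hcomp : Compatible (Covers X) cut (i + 1) r' A B ↔
          Compatible (Covers X) cut i r' A B ∧ ¬ conflictTest.Holds τ₃ := by
        rw [Compatible, forall_lt_succ_iff, Compatible]
        refine and_congr_right fun _ => ?_
        simp only [conflictTest, holds_boolOr, BoolExpr.Holds, holds_natLt, NatExpr.eval, e6, e7,
          h8, e4, e15, ecut]
        omega
      rw [hcomp]
      refine Within.time_mono (Within.cond (fun h => Within.setNat ?_) fun h => Within.skip ?_) ?_
      · simp [NatExpr.eval, h]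
      · simp [h, e21, hI]
      · simp [conflictTest, boolOr, natLt, BoolExpr.cost, NatExpr.cost]
  · simp [natEq, BoolExpr.cost, NatExpr.cost]
  · nlinarith

/-- Put the offset of `src`, relative to the first point, into the real variable `0`. -/
def computeOffset (K : ℕ) (src : RealExpr) : Program :=
  .seq (.setReal 0 (.add (.sub src (.get 0 (.const 0))) (.const (K + 1))))
    (forLoop 9 (.const (2 * K + 1))
      (.cond (.realLe (.const 1) (.var 0)) (.setReal 0 (.sub (.var 0) (.const 1))) .skip))

theorem computeOffset_spec {K : ℕ} {src : RealExpr} {σ : State} {x x₀ : ℝ}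
    (hx : src.eval σ = x) (hx₀ : σ.realArr 0 0 = x₀) :
    Within (computeOffset K src) (src.cost + (2 * K + 2) * 40) σ fun τ =>
      τ.realVar 0 = offset K (x - x₀) := by
  refine Within.time_mono (Within.seq (Within.setReal (Within.forLoop (b := 2 * K + 1)
    (Y := 2 * K + 1) (T := 10)
    (fun i τ => τ.realVar 0 = decrease^[i] (x - x₀ + (K + 1 : ℕ))) rfl le_rfl (by omega) ?_ ?_ ?_)))
    ?_
  · intro τ _; rfl
  · simp [RealExpr.eval, NatExpr.eval, hx, hx₀]
  · intro i τ _ _ _ hI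
    rw [Function.iterate_succ_apply', ← hI]
    refine Within.time_mono (Within.cond (fun h => Within.setReal ?_) fun h => Within.skip ?_) ?_
    · simp only [BoolExpr.Holds, RealExpr.eval, Int.cast_one] at h
      simp [RealExpr.eval, decrease, h]
    · simp only [BoolExpr.Holds, RealExpr.eval, Int.cast_one] at h
      simp [decrease, h]
    · simp [BoolExpr.cost, RealExpr.cost]
  · simp only [RealExpr.cost, NatExpr.cost]
    omega

/-- Put the offsets of the squares into the real array `4`. -/
def computeOffsets (K : ℕ) : Program :=
  forLoop 5 (.var 1) (.seq (computeOffset K (.get 2 (.var 5))) (.putReal 4 (.var 5) (.var 0)))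

theorem computeOffsets_spec {K n m Y : ℕ} {X : ℕ → ℕ → ℝ} {σ : State} (hσ : HasInput n m X σ)
    (hmY : m ≤ Y) (hY : 1 ≤ Y) :
    Within (computeOffsets K) (Y * ((K + 1) * 110)) σ fun τ =>
      ∀ j < m, τ.realArr 4 j = offset K (X 2 j - X 0 0) := by
  refine Within.time_mono (Within.forLoop (b := m) (Y := Y) (T := (2 + (2 * K + 2) * 40) + 3)
    (fun i τ => ∀ j < i, τ.realArr 4 j = offset K (X 2 j - X 0 0)) rfl hmY hY ?_ ?_ ?_) ?_
  · intro τ hF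
    exact (hF.natVar 1 rfl).trans hσ.m_eq
  · simp
  · intro i τ hi hF h5 hI
    have hτ : HasInput n m X τ := hσ.frame ⟨⟨rfl, rfl⟩, ⟨rfl, rfl⟩, rfl, rfl⟩ hF
    refine Within.seq ((computeOffset_spec (x := X 2 i) (x₀ := X 0 0) ?_ ?_).imp le_rfl ?_)
    · simp [RealExpr.eval, NatExpr.eval, h5, hτ.row2]
    · simp [hτ.row0]
    · intro υ hF' h0
      refine Within.putReal (i := .var 5) (e := .var 0) ?_
      have e5 : υ.natVar 5 = i := (hF'.natVar 5 rfl).trans h5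
      have e4 : υ.realArr 4 = τ.realArr 4 := hF'.realArr 4 rfl
      intro j hj
      simp only [NatExpr.eval, RealExpr.eval, State.setNat_realArr, State.putReal_realArr, if_true,
        e5, h0, e4, Function.update_apply]
      split_ifs with h
      · rw [h]
      · exact hI j (by omega)
  · refine Nat.mul_le_mul_left _ ?_
    simp only [NatExpr.cost]
    omega

/-- The sweep line passes square `j` before point `q`, where `j` and `q` are the natural variables
`5` and `4` and the offset of `q` is the real variable `0`. -/
def beforeTest : BoolExpr :=
  boolOr (.not (.realLe (.var 0) (.get 4 (.var 5))))
    (.and (.realLe (.get 4 (.var 5)) (.var 0)) (.realLe (.get 0 (.var 4)) (.get 2 (.var 5))))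

/-- Put the cuts of the points into the natural array `1`. -/
def computeCuts (K : ℕ) : Program :=
  forLoop 4 (.var 0) (.seq (computeOffset K (.get 0 (.var 4)))
    (.seq (countIf 6 beforeTest) (.putNat 1 (.var 4) (.var 6))))

theorem computeCuts_spec {K n m Y : ℕ} {X : ℕ → ℕ → ℝ} {σ : State} (hσ : HasInput n m X σ)
    (hoff : ∀ j < m, σ.realArr 4 j = offset K (X 2 j - X 0 0)) (hmY : m ≤ Y) (hY : 1 ≤ Y) :
    Within (computeCuts K) ((n + 1) * (Y * ((K + 1) * 170))) σ fun τ =>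
      ∀ q < n, τ.natArr 1 q = cutIndex K X m q := by
  classical
  refine Within.time_mono (Within.forLoop (b := n) (Y := n + 1)
    (T := (2 + (2 * K + 2) * 40) + (Y * 55 + 3))
    (fun i τ => ∀ q < i, τ.natArr 1 q = cutIndex K X m q) rfl (Nat.le_succ n) (by omega) ?_ ?_ ?_) ?_
  · intro τ hF
    exact (hF.natVar 0 rfl).trans hσ.n_eq
  · simp
  · intro i τ hi hF h4 hI
    have hτ : HasInput n m X τ := hσ.frame ⟨⟨rfl, rfl⟩, ⟨rfl, rfl⟩, rfl, rfl⟩ hF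
    have hoffτ : ∀ j < m, τ.realArr 4 j = offset K (X 2 j - X 0 0) := by
      rw [hF.realArr 4 rfl]; exact hoff
    refine Within.seq ((computeOffset_spec (x := X 0 i) (x₀ := X 0 0) ?_ ?_).imp le_rfl ?_)
    · simp [RealExpr.eval, NatExpr.eval, h4, hτ.row0]
    · simp [hτ.row0]
    · intro υ hF' h0
      have hυ : HasInput n m X υ := hτ.frame ⟨⟨rfl, rfl⟩, ⟨rfl, rfl⟩, rfl, rfl⟩ hF'
      refine Within.seq ((countIf_spec (pr := fun j => Before K X j i) (by omega) (by omega)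
        hυ.m_eq hmY hY ?_).imp ?_ ?_)
      · intro j hj χ hFχ h5
        have hχ : HasInput n m X χ := hυ.frame ⟨⟨rfl, rfl⟩, ⟨rfl, rfl⟩, rfl, rfl⟩ hFχ
        have e4 : χ.natVar 4 = i :=
          ((hFχ.natVar 4 rfl).trans (hF'.natVar 4 rfl)).trans h4
        have e0 : χ.realVar 0 = offset K (X 0 i - X 0 0) := (hFχ.realVar 0 rfl).trans h0
        have eo : χ.realArr 4 j = offset K (X 2 j - X 0 0) := by
          rw [hFχ.realArr 4 rfl, hF'.realArr 4 rfl]; exact hoffτ j hj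
        simp only [beforeTest, holds_boolOr, BoolExpr.Holds, RealExpr.eval, NatExpr.eval, h5, e4,
          e0, eo, hχ.row0, hχ.row2, Before, not_le]
        constructor
        · rintro (h | ⟨h, h'⟩)
          · exact Or.inl h
          · exact h.lt_or_eq.imp_right fun h => ⟨h, h'⟩
        · rintro (h | ⟨h, h'⟩)
          · exact Or.inl h
          · exact Or.inr ⟨h.le, h'⟩
      · simp [beforeTest, boolOr, BoolExpr.cost, RealExpr.cost, NatExpr.cost]
        omega
      · intro χ hFχ h6
        refine Within.putNat (i := .var 4) (e := .var 6) ?_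
        have e4 : χ.natVar 4 = i :=
          ((hFχ.natVar 4 rfl).trans (hF'.natVar 4 rfl)).trans h4
        have e1 : χ.natArr 1 = τ.natArr 1 := (hFχ.natArr 1 rfl).trans (hF'.natArr 1 rfl)
        intro q hq
        simp only [NatExpr.eval, State.setNat_natArr, State.putNat_natArr, if_true, e4, h6, e1,
          Function.update_apply]
        split_ifs with h
        · rw [h]; rfl
        · exact hI q (by omega)
  · refine Nat.mul_le_mul_left _ ?_
    simp only [NatExpr.cost]
    have h1 : K + 1 ≤ Y * (K + 1) := Nat.le_mul_of_pos_left _ hY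
    have h2 : Y ≤ Y * (K + 1) := Nat.le_mul_of_pos_right _ (by omega)
    linarith

/-- Put the number `(m + 1) ^ (L + 1)` of nodes into the natural variable `3`. -/
def computePower (L : ℕ) : Program :=
  .seq (.setNat 3 (.const 1)) (forLoop 9 (.const (L + 1))
    (.seq (.setNat 10 (.const 0))
      (.seq (forLoop 20 (.add (.var 1) (.const 1)) (.setNat 10 (.add (.var 10) (.var 3))))
        (.setNat 3 (.var 10)))))

theorem computePower_spec {L m Y : ℕ} {σ : State} (hm : σ.natVar 1 = m) (hmY : m + 1 ≤ Y) :
    Within (computePower L) (Y * ((L + 1) * 60)) σ fun τ => τ.natVar 3 = (m + 1) ^ (L + 1) := by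
  have hY : 1 ≤ Y := by omega
  refine Within.time_mono (Within.seq (Within.setNat (Within.forLoop (b := L + 1) (Y := L + 1)
    (T := 2 + (Y * (4 + 16 + 2 * 3) + 2)) (fun i τ => τ.natVar 3 = (m + 1) ^ i) rfl le_rfl
    (by omega) ?_ ?_ ?_))) ?_
  · intro τ _; rfl
  · simp [NatExpr.eval]
  · intro i τ hi hF _ hI
    have hτ1 : τ.natVar 1 = m := (hF.natVar 1 rfl).trans hm
    refine Within.seq (Within.setNat (Within.seq (Within.imp (Within.forLoop (b := m + 1) (Y := Y)
      -- Multiplication by `m + 1` is repeated addition.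
      (T := 4) (fun j υ => υ.natVar 10 = (m + 1) ^ i * j) rfl hmY hY ?_ ?_ ?_) le_rfl ?_)))
    · intro υ hF'
      have : υ.natVar 1 = m := (hF'.natVar 1 rfl).trans hτ1
      simp [NatExpr.eval, this]
    · simp [NatExpr.eval]
    · intro j υ hj hF' _ hJ
      have : υ.natVar 3 = (m + 1) ^ i := (hF'.natVar 3 rfl).trans hI
      refine Within.setNat (e := .add (.var 10) (.var 3)) ?_
      simp [NatExpr.eval, this, hJ]
      ring
    · intro υ _ h
      refine Within.setNat (e := .var 10) ?_
      simp [NatExpr.eval, h, pow_succ]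
  · simp only [NatExpr.cost]
    have h1 : L + 1 ≤ Y * (L + 1) := Nat.le_mul_of_pos_left _ hY
    have h2 : Y ≤ Y * (L + 1) := Nat.le_mul_of_pos_right _ (by omega)
    nlinarith

end Preparation


/-! ### The dynamic program -/

namespace Network

variable {G : Network} {best prev best' prev' : ℕ → ℕ} {N s : ℕ}

theorem TableAt.congr (h : G.TableAt best prev s) (hb : ∀ t ≤ s, best' t = best t)
    (hp : prev' s = prev s) : G.TableAt best' prev' s := by
  refine ⟨fun h0 => ?_, fun hv hl => ?_, fun hv t ht he h0 => ?_⟩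
  · rw [hb s le_rfl] at h0 ⊢
    refine ⟨(h.attained h0).1, (h.attained h0).2.imp_right ?_⟩
    rintro ⟨h1, h2, h3, h4⟩
    rw [hp, hb _ h1.le]
    exact ⟨h1, h2, h3, h4⟩
  · rw [hb s le_rfl]; exact h.start_le hv hl
  · rw [hb t ht.le] at h0 ⊢
    rw [hb s le_rfl]
    exact h.step_le hv t ht he h0

variable (G) in
/-- `cur` and `pr` are the entries of the tables at `s` if only predecessors `t < i` are taken into
account. -/
structure PartialTableAt (best : ℕ → ℕ) (s i cur pr : ℕ) : Prop where
  attained : cur ≠ 0 → G.Valid s ∧ ((G.layer s = 0 ∧ cur = G.value s + 1) ∨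
    (pr < i ∧ G.Edge pr s ∧ best pr ≠ 0 ∧ cur = best pr + G.value s))
  start_le : G.Valid s → G.layer s = 0 → G.value s + 1 ≤ cur
  step_le : G.Valid s → ∀ t < i, G.Edge t s → best t ≠ 0 → best t + G.value s ≤ cur

/-- When all `t < s` have been considered, the entries are final: predecessors with larger numbers
do not enter, and storing at `s` leaves the entries consulted intact. -/
theorem PartialTableAt.tableAt {cur pr : ℕ} (h : G.PartialTableAt best s s cur pr)
    (hb : ∀ t < s, best' t = best t) (hbs : best' s = cur) (hps : prev' s = pr) :
    G.TableAt best' prev' s := by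
  refine ⟨fun h0 => ?_, fun hv hl => ?_, fun hv t ht he h0 => ?_⟩
  · rw [hbs] at h0 ⊢
    refine ⟨(h.attained h0).1, (h.attained h0).2.imp_right ?_⟩
    rintro ⟨h1, h2, h3, h4⟩
    rw [hps, hb _ h1]
    exact ⟨h1, h2, h3, h4⟩
  · rw [hbs]; exact h.start_le hv hl
  · rw [hb t ht] at h0 ⊢
    rw [hbs]
    exact h.step_le hv t ht he h0

/-- The time for decoding a node is bounded through a bound on its number, which is needed along the
whole traced path. -/
theorem iterate_prev_lt (h : ∀ s < N, G.TableAt best prev s) {l : ℕ} (hs : s < N)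
    (hl : G.layer s = l) (hb : best s ≠ 0) : ∀ i ≤ l, prev^[i] s < N := by
  induction l generalizing s with
  | zero =>
    intro i hi
    rw [Nat.le_zero.1 hi]
    exact hs
  | succ l ih =>
    rintro (_ | i) hi
    · exact hs
    · obtain ⟨hv, ⟨h0, -⟩ | ⟨hlt, he, hb', -⟩⟩ := (h s hs).attained hb
      · omega
      · exact ih (hlt.trans hs) (by have := he.1; omega) hb' i (by omega)

end Network

/-! ### Programs that fill, search and trace the tables -/

section Main

theorem nodeSet_subset (m L s : ℕ) : nodeSet m L s ⊆ Finset.range m := fun _ hj =>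
  Finset.mem_range.2 (Finset.mem_filter.1 hj).2

/-- Improve the entries for the node in the natural variable `12` by a path through the node in the
natural variable `13`. -/
def relax (L : ℕ) : Program :=
  .seq (decode L 13 2 14) (.seq checkEdge
    (.cond (.and (.and (natEq (.var 16) (.const 1)) (natEq (.var 21) (.const 1)))
        (.and (.natLe (.const 1) (.get 4 (.var 13)))
          (natLt (.var 18) (.add (.get 4 (.var 13)) (.var 17)))))
      (.seq (.setNat 18 (.add (.get 4 (.var 13)) (.var 17))) (.setNat 19 (.var 13)))
      .skip))

/-- The node in the natural variable `12` has been decoded and checked. -/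
structure NodeLoaded (K L n m : ℕ) (X : ℕ → ℕ → ℝ) (s : ℕ) (σ : State) : Prop where
  input : HasInput n m X σ
  cut : ∀ q < n, σ.natArr 1 q = cutIndex K X m q
  node : σ.natVar 12 = s
  layer : σ.natVar 15 = s / (m + 1) ^ L
  set : Represents m 3 σ (nodeSet m L s)
  valid : σ.natVar 16 = 1 ↔ (sweepNetwork K L n m X).Valid s
  value : σ.natVar 17 = (sweepNetwork K L n m X).value s

theorem relax_spec {K L n m s t Y : ℕ} {X : ℕ → ℕ → ℝ} {σ : State} {best : ℕ → ℕ}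
    (hσ : NodeLoaded K L n m X s σ) (hbest : σ.natArr 4 = best) (ht : σ.natVar 13 = t)
    (htY : t < Y) (hmY : m ≤ Y)
    (hI : (sweepNetwork K L n m X).PartialTableAt best s t (σ.natVar 18) (σ.natVar 19)) :
    Within (relax L) ((n + 1) * (Y * (L + 1)) * 440) σ fun τ =>
      (sweepNetwork K L n m X).PartialTableAt best s (t + 1) (τ.natVar 18) (τ.natVar 19) := by
  have hY : 1 ≤ Y := by omega
  refine Within.time_mono (Within.seq (U := (n + 1) * (Y * 310) + 40)
    ((decode_spec (by omega) hσ.input.m_eq ht htY hmY).imp le_rfl ?_)) ?_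
  · rintro τ hF ⟨hrep, h14⟩
    refine Within.seq ((checkEdge_spec (cut := cutIndex K X m)
      (hσ.input.frame ⟨⟨rfl, rfl⟩, ⟨rfl, rfl⟩, rfl, rfl⟩ hF)
      (fun q hq => by rw [hF.natArr 1 rfl]; exact hσ.cut q hq) h14
      ((hF.natVar 15 rfl).trans hσ.layer) (nodeSet_subset _ _ _) (nodeSet_subset _ _ _) hrep
      (hσ.set.congr (hF.natArr 3 rfl)) hmY hY).imp le_rfl ?_)
    intro υ hF' h21
    -- What the edge test decides is definitionally the edge relation of the sweep network.
    change υ.natVar 21 = 1 ↔ (sweepNetwork K L n m X).Edge t s at h21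
    have e4 : υ.natArr 4 = best := ((hF'.natArr 4 rfl).trans (hF.natArr 4 rfl)).trans hbest
    have e13 : υ.natVar 13 = t := ((hF'.natVar 13 rfl).trans (hF.natVar 13 rfl)).trans ht
    have e16 : υ.natVar 16 = 1 ↔ (sweepNetwork K L n m X).Valid s := by
      rw [hF'.natVar 16 rfl, hF.natVar 16 rfl]; exact hσ.valid
    have e17 : υ.natVar 17 = (sweepNetwork K L n m X).value s :=
      ((hF'.natVar 17 rfl).trans (hF.natVar 17 rfl)).trans hσ.value
    have e18 : υ.natVar 18 = σ.natVar 18 := (hF'.natVar 18 rfl).trans (hF.natVar 18 rfl)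
    have e19 : υ.natVar 19 = σ.natVar 19 := (hF'.natVar 19 rfl).trans (hF.natVar 19 rfl)
    refine Within.time_mono (Within.cond (T := 7) (fun h => Within.time_mono
      (Within.seq (Within.setNat (Within.setNat ?_))) ?_) (fun h => Within.skip ?_)) ?_
    · simp only [BoolExpr.Holds, holds_natEq, holds_natLt, NatExpr.eval, e4, e13, e16, e17, e18,
        h21] at h
      obtain ⟨⟨hv, he⟩, hb, hlt⟩ := h
      simp only [NatExpr.eval, State.setNat_natVar, if_true, Nat.reduceEqDiff, if_false, e13, e4, e17]
      refine ⟨fun _ => ⟨hv, Or.inr ⟨Nat.lt_succ_self t, he, by omega, rfl⟩⟩, fun _ hl => ?_,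
        fun _ t' ht' he' h0 => ?_⟩
      · have := hI.start_le hv hl
        omega
      · rcases Nat.lt_succ_iff_lt_or_eq.1 ht' with ht' | rfl
        · have := hI.step_le hv t' ht' he' h0
          omega
        · exact le_rfl
    · simp [NatExpr.cost]
    · simp only [BoolExpr.Holds, holds_natEq, holds_natLt, NatExpr.eval, e4, e13, e16, e17, e18,
        h21] at h
      rw [e18, e19]
      refine ⟨fun h0 => ⟨(hI.attained h0).1, (hI.attained h0).2.imp_right
        fun h => ⟨Nat.lt_succ_of_lt h.1, h.2⟩⟩, hI.start_le, fun hv t' ht' he' h0 => ?_⟩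
      rcases Nat.lt_succ_iff_lt_or_eq.1 ht' with ht' | rfl
      · exact hI.step_le hv t' ht' he' h0
      · by_contra hn
        -- A violated bound would have made the test for an improvement succeed.
        exact h ⟨⟨hv, he'⟩, by omega, by omega⟩
    · simp [natEq, natLt, BoolExpr.cost, NatExpr.cost]
  · have h1 : Y * (L + 1) ≤ (n + 1) * (Y * (L + 1)) := Nat.le_mul_of_pos_left _ (by omega)
    have h2 : (n + 1) * Y ≤ (n + 1) * Y * (L + 1) := Nat.le_mul_of_pos_right _ (by omega)
    have h3 : 1 ≤ (n + 1) * (Y * (L + 1)) := Nat.mul_pos (by omega) (Nat.mul_pos hY (by omega))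
    nlinarith

/-- Compute the entries of the tables for the node in the natural variable `12`. -/
def processNode (L : ℕ) : Program :=
  .seq (decode L 12 3 15) (.seq checkNode (.seq (.setNat 19 (.const 0))
    (.seq (.cond (.and (natEq (.var 16) (.const 1)) (natEq (.var 15) (.const 0)))
        (.setNat 18 (.add (.var 17) (.const 1))) (.setNat 18 (.const 0)))
      (.seq (forLoop 13 (.var 12) (relax L))
        (.seq (.putNat 4 (.var 12) (.var 18)) (.putNat 5 (.var 12) (.var 19)))))))

theorem processNode_spec {K L n m s Y : ℕ} {X : ℕ → ℕ → ℝ} {σ : State}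
    (hσ : HasInput n m X σ) (hcut : ∀ q < n, σ.natArr 1 q = cutIndex K X m q)
    (hs : σ.natVar 12 = s) (hsY : s < Y) (hmY : m ≤ Y)
    (hI : ∀ t < s, (sweepNetwork K L n m X).TableAt (σ.natArr 4) (σ.natArr 5) t) :
    Within (processNode L) (Y * ((n + 1) * (Y * (L + 1)) * 730)) σ fun τ =>
      ∀ t < s + 1, (sweepNetwork K L n m X).TableAt (τ.natArr 4) (τ.natArr 5) t := by
  have hY : 1 ≤ Y := by omega
  refine Within.time_mono (Within.seq
    (U := (n + 1) * (Y * 140) + (2 + (30 + (Y * ((n + 1) * (Y * (L + 1)) * 440 + 16 + 2 * 1) + 6))))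
    ((decode_spec (by omega) hσ.m_eq hs hsY hmY).imp le_rfl ?_)) ?_
  · rintro τ hF ⟨hrep, h15⟩
    have hτ : HasInput n m X τ := hσ.frame ⟨⟨rfl, rfl⟩, ⟨rfl, rfl⟩, rfl, rfl⟩ hF
    have hcutτ : ∀ q < n, τ.natArr 1 q = cutIndex K X m q := fun q hq => by
      rw [hF.natArr 1 rfl]; exact hcut q hq
    refine Within.seq ((checkNode_spec hτ hcutτ h15 (nodeSet_subset _ _ _) hrep hmY hY).imp
      le_rfl ?_)
    rintro υ hF' ⟨h16, h17⟩
    have hυ : NodeLoaded K L n m X s υ :=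
      ⟨hτ.frame ⟨⟨rfl, rfl⟩, ⟨rfl, rfl⟩, rfl, rfl⟩ hF',
        fun q hq => by rw [hF'.natArr 1 rfl]; exact hcutτ q hq,
        ((hF'.natVar 12 rfl).trans (hF.natVar 12 rfl)).trans hs,
        (hF'.natVar 15 rfl).trans h15, hrep.congr (hF'.natArr 3 rfl), h16, h17⟩
    have e4 : υ.natArr 4 = σ.natArr 4 := (hF'.natArr 4 rfl).trans (hF.natArr 4 rfl)
    have e5 : υ.natArr 5 = σ.natArr 5 := (hF'.natArr 5 rfl).trans (hF.natArr 5 rfl)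
    refine Within.seq (Within.setNat (Within.seq (T := 30) (Within.time_mono (Within.imp
      (Q := fun χ => (sweepNetwork K L n m X).PartialTableAt (σ.natArr 4) s 0 (χ.natVar 18)
        (χ.natVar 19)) (Within.cond (fun h => Within.setNat ?_) fun h => Within.setNat ?_)
      le_rfl ?_) ?_)))
    · simp only [BoolExpr.Holds, holds_natEq, NatExpr.eval, State.setNat_natVar, Nat.reduceEqDiff,
        if_false, hυ.valid, hυ.layer] at h
      simp only [NatExpr.eval, State.setNat_natVar, Nat.reduceEqDiff, if_false, if_true, hυ.value]
      exact ⟨fun _ => ⟨h.1, Or.inl ⟨h.2, rfl⟩⟩, fun _ _ => le_rfl, fun _ t ht => absurd ht (by omega)⟩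
    · simp only [BoolExpr.Holds, holds_natEq, NatExpr.eval, State.setNat_natVar, Nat.reduceEqDiff,
        if_false, hυ.valid, hυ.layer] at h
      simp only [NatExpr.eval, State.setNat_natVar, Nat.reduceEqDiff, if_false, if_true]
      exact ⟨fun h0 => absurd rfl h0, fun hv hl => absurd ⟨hv, hl⟩ h,
        fun _ t ht => absurd ht (by omega)⟩
    · intro χ hFχ hχ
      have hload : ∀ ψ, Frame (forLoop 13 (.var 12) (relax L)) χ ψ →
          ψ.natVar 12 = s ∧ ψ.natArr 4 = σ.natArr 4 ∧ ψ.natArr 5 = σ.natArr 5 := by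
        intro ψ hFψ
        refine ⟨((hFψ.natVar 12 rfl).trans (hFχ.natVar 12 rfl)).trans hυ.node,
          ((hFψ.natArr 4 rfl).trans (hFχ.natArr 4 rfl)).trans e4,
          ((hFψ.natArr 5 rfl).trans (hFχ.natArr 5 rfl)).trans e5⟩
      refine Within.seq (Within.imp (Within.forLoop (b := s) (Y := Y)
        (T := (n + 1) * (Y * (L + 1)) * 440)
        (fun i ψ => (sweepNetwork K L n m X).PartialTableAt (σ.natArr 4) s i (ψ.natVar 18)
          (ψ.natVar 19)) rfl hsY.le hY ?_ ?_ ?_) le_rfl ?_)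
      · intro ψ hFψ
        exact (hload ψ hFψ).1
      · simpa using hχ
      · intro i ψ hi hFψ h13 hψ
        refine (relax_spec (s := s) ?_ (hload ψ hFψ).2.1 h13 (hi.trans hsY) hmY hψ).imp le_rfl ?_
        · refine ⟨((hυ.input.setNat (x := 19) (by omega)).frame ⟨⟨rfl, rfl⟩, ⟨rfl, rfl⟩, rfl, rfl⟩
            hFχ).frame ⟨⟨rfl, rfl⟩, ⟨rfl, rfl⟩, rfl, rfl⟩ hFψ, fun q hq => ?_, (hload ψ hFψ).1,
            ((hFψ.natVar 15 rfl).trans (hFχ.natVar 15 rfl)).trans hυ.layer,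
            (hυ.set.congr (hFχ.natArr 3 rfl)).congr (hFψ.natArr 3 rfl), ?_,
            ((hFψ.natVar 17 rfl).trans (hFχ.natVar 17 rfl)).trans hυ.value⟩
          · rw [hFψ.natArr 1 rfl, hFχ.natArr 1 rfl]; exact hυ.cut q hq
          · rw [hFψ.natVar 16 rfl, hFχ.natVar 16 rfl]; exact hυ.valid
        · intro ω _ hω
          simpa using hω
      · intro ψ hFψ hψ
        obtain ⟨f12, f4, f5⟩ := hload ψ hFψ
        refine Within.time_mono (Within.seq (Within.putNat (i := .var 12) (e := .var 18)
          (Within.putNat (i := .var 12) (e := .var 19) ?_))) ?_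
        · simp only [NatExpr.eval, State.putNat_natVar, State.putNat_natArr, f12, f4, f5,
            if_true, Nat.reduceEqDiff, if_false]
          intro t ht
          rcases Nat.lt_succ_iff_lt_or_eq.1 ht with ht | rfl
          · exact (hI t ht).congr (fun t' ht' => Function.update_of_ne (by omega) _ _)
              (Function.update_of_ne (by omega) _ _)
          · exact hψ.tableAt (fun t' ht' => Function.update_of_ne (by omega) _ _)
              (Function.update_self ..) (Function.update_self ..)
        · simp [NatExpr.cost]
    · simp [natEq, BoolExpr.cost, NatExpr.cost]
  · set Z := (n + 1) * (Y * (L + 1)) with hZ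
    have h1 : Y * (L + 1) ≤ Z := Nat.le_mul_of_pos_left _ (by omega)
    have h2 : (n + 1) * Y ≤ (n + 1) * Y * (L + 1) := Nat.le_mul_of_pos_right _ (by omega)
    rw [mul_assoc, ← hZ] at h2
    have h3 : 1 ≤ Z := Nat.mul_pos (by omega) (Nat.mul_pos hY (by omega))
    have h4 : Z ≤ Y * Z := Nat.le_mul_of_pos_left _ hY
    have h5 : Y ≤ Y * Z := Nat.le_mul_of_pos_right _ h3
    have e1 : Y * ((L + 1) * 90) = Y * (L + 1) * 90 := by ring
    have e2 : (n + 1) * (Y * 140) = (n + 1) * Y * 140 := by ring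
    have e3 : Y * (Z * 440 + 16 + 2 * 1) = Y * Z * 440 + Y * 18 := by ring
    have e4 : Y * (Z * 730) = Y * Z * 730 := by ring
    rw [e1, e2, e3, e4]
    omega

/-- Compute the tables in the natural arrays `4` and `5`. -/
def fillTables (L : ℕ) : Program := forLoop 12 (.var 3) (processNode L)

theorem fillTables_spec {K L n m Y : ℕ} {X : ℕ → ℕ → ℝ} {σ : State}
    (hσ : HasInput n m X σ) (hcut : ∀ q < n, σ.natArr 1 q = cutIndex K X m q)
    (hN : σ.natVar 3 = Y) (hmY : m + 1 ≤ Y) :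
    Within (fillTables L) (Y * (Y * ((n + 1) * (Y * (L + 1)) * 750))) σ fun τ =>
      ∀ s < Y, (sweepNetwork K L n m X).TableAt (τ.natArr 4) (τ.natArr 5) s := by
  refine Within.time_mono (Within.forLoop (b := Y) (Y := Y)
    (T := Y * ((n + 1) * (Y * (L + 1)) * 730))
    (fun i τ => ∀ s < i, (sweepNetwork K L n m X).TableAt (τ.natArr 4) (τ.natArr 5) s)
    rfl le_rfl (by omega) ?_ ?_ ?_) ?_
  · intro τ hF
    exact (hF.natVar 3 rfl).trans hN
  · intro s hs
    exact absurd hs (by omega)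
  · intro i τ hi hF h12 hI
    refine (processNode_spec (hσ.frame ⟨⟨rfl, rfl⟩, ⟨rfl, rfl⟩, rfl, rfl⟩ hF)
      (fun q hq => by rw [hF.natArr 1 rfl]; exact hcut q hq) h12 hi (by omega) hI).imp le_rfl ?_
    intro υ _ h
    simpa using h
  · refine Nat.mul_le_mul_left _ ?_
    have h3 : 1 ≤ (n + 1) * (Y * (L + 1)) :=
      Nat.mul_pos (by omega) (Nat.mul_pos (by omega) (by omega))
    have h4 : 1 ≤ Y * ((n + 1) * (Y * (L + 1))) := Nat.mul_pos (by omega) h3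
    simp only [NatExpr.cost]
    linarith

/-- Put the largest entry of the first table in the last layer and its position into the natural
variables `18` and `19`. -/
def findBest (L : ℕ) : Program :=
  .seq (.setNat 18 (.const 0)) (.seq (.setNat 19 (.const 0)) (forLoop 12 (.var 3)
    (.seq (decode L 12 3 15)
      (.cond (.and (natEq (.var 15) (.var 1)) (natLt (.var 18) (.get 4 (.var 12))))
        (.seq (.setNat 18 (.get 4 (.var 12))) (.setNat 19 (.var 12))) .skip))))

/-- The search starts from `0` and replaces only on strict improvement. So `0` survives exactly when
the last layer has no positive entry, and a position is claimed only for a nonzero maximum. -/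
theorem findBest_spec {L m Y : ℕ} {σ : State} {best : ℕ → ℕ} (hm : σ.natVar 1 = m)
    (hN : σ.natVar 3 = Y) (hmY : m + 1 ≤ Y) (hbest : σ.natArr 4 = best) :
    Within (findBest L) (Y * (Y * ((L + 1) * 150))) σ fun τ =>
      (τ.natVar 18 ≠ 0 → τ.natVar 19 < Y ∧ τ.natVar 19 / (m + 1) ^ L = m ∧
        best (τ.natVar 19) = τ.natVar 18) ∧
      ∀ s < Y, s / (m + 1) ^ L = m → best s ≤ τ.natVar 18 := by
  refine Within.time_mono (Within.seq (Within.setNat (Within.seq (Within.setNat (Within.forLoop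
    (b := Y) (Y := Y) (T := Y * ((L + 1) * 90) + 30)
    (fun i τ => (τ.natVar 18 ≠ 0 → τ.natVar 19 < Y ∧ τ.natVar 19 / (m + 1) ^ L = m ∧
        best (τ.natVar 19) = τ.natVar 18) ∧
      ∀ s < i, s / (m + 1) ^ L = m → best s ≤ τ.natVar 18)
    rfl le_rfl (by omega) ?_ ?_ ?_))))) ?_
  · intro τ hF
    exact (hF.natVar 3 rfl).trans hN
  · simp [NatExpr.eval]
  · rintro i τ hi hF h12 ⟨hI, hmax⟩
    have hτ1 : τ.natVar 1 = m := (hF.natVar 1 rfl).trans hm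
    refine Within.seq ((decode_spec (by omega) hτ1 h12 hi (by omega)).imp le_rfl ?_)
    rintro υ hF' ⟨-, h15⟩
    have e1 : υ.natVar 1 = m := (hF'.natVar 1 rfl).trans hτ1
    have e4 : υ.natArr 4 = best := ((hF'.natArr 4 rfl).trans (hF.natArr 4 rfl)).trans hbest
    have e12 : υ.natVar 12 = i := (hF'.natVar 12 rfl).trans h12
    have e18 : υ.natVar 18 = τ.natVar 18 := hF'.natVar 18 rfl
    have e19 : υ.natVar 19 = τ.natVar 19 := hF'.natVar 19 rfl
    refine Within.time_mono (Within.cond (T := 5) (fun h => Within.time_mono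
      (Within.seq (Within.setNat (Within.setNat ?_))) ?_) fun h => Within.skip ?_) ?_
    · simp only [BoolExpr.Holds, holds_natEq, holds_natLt, NatExpr.eval, e1, e4, e12, e18, h15] at h
      simp only [NatExpr.eval, State.setNat_natVar, Nat.reduceEqDiff, if_false, if_true, e4, e12]
      exact ⟨fun _ => ⟨hi, h.1, trivial⟩, forall_lt_succ_iff.2
        ⟨fun s hs hl => (hmax s hs hl).trans h.2.le, fun _ => le_rfl⟩⟩
    · simp [NatExpr.cost]
    · simp only [BoolExpr.Holds, holds_natEq, holds_natLt, NatExpr.eval, e1, e4, e12, e18, h15] at h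
      simp only [State.setNat_natVar, Nat.reduceEqDiff, if_false, e18, e19]
      exact ⟨hI, forall_lt_succ_iff.2 ⟨hmax, fun hl => not_lt.1 fun hlt => h ⟨hl, hlt⟩⟩⟩
    · simp [natEq, natLt, BoolExpr.cost, NatExpr.cost]
  · have h1 : 1 ≤ Y * (L + 1) := Nat.mul_pos (by omega) (by omega)
    have h2 : Y ≤ Y * (Y * (L + 1)) := Nat.le_mul_of_pos_right _ h1
    simp only [NatExpr.cost]
    nlinarith

/-- Mark in the natural array `0` the squares in the collection in the natural array `3`. -/
def markMembers : Program :=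
  forLoop 5 (.var 1) (.cond (memTest 3) (.putNat 0 (.var 5) (.const 1)) .skip)

theorem markMembers_spec {m Y : ℕ} {σ : State} {W : Finset ℕ} (hm : σ.natVar 1 = m)
    (hrep : Represents m 3 σ W) (hmY : m ≤ Y) (hY : 1 ≤ Y) :
    Within markMembers (Y * 30) σ fun τ =>
      ∀ j < m, (τ.natArr 0 j = 1 ↔ σ.natArr 0 j = 1 ∨ j ∈ W) := by
  refine Within.time_mono (Within.imp (Within.forLoop (b := m) (Y := Y) (T := 9)
    (fun i τ => ∀ j, (τ.natArr 0 j = 1 ↔ σ.natArr 0 j = 1 ∨ (j < i ∧ j ∈ W)))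
    rfl hmY hY ?_ ?_ ?_) le_rfl ?_) ?_
  · intro τ hF
    exact (hF.natVar 1 rfl).trans hm
  · simp
  · intro i τ hi hF h5 hI
    have hiff : (memTest 3).Holds τ ↔ i ∈ W := by
      rw [← hrep i hi, ← hF.natArr 3 rfl]
      simp [memTest, BoolExpr.Holds, NatExpr.eval, h5]
    refine Within.time_mono (Within.cond
      (fun h => Within.putNat (i := .var 5) (e := .const 1) ?_) fun h => Within.skip ?_) ?_
    · intro j
      simp only [NatExpr.eval, State.setNat_natArr, State.putNat_natArr, if_true, h5,
        Function.update_apply]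
      split_ifs with hj
      · simp [hj, hiff.1 h]
      · rw [hI j]
        exact or_congr_right (and_congr_left fun _ => by omega)
    · intro j
      rw [State.setNat_natArr, hI j]
      refine or_congr_right ⟨fun h' => ⟨by omega, h'.2⟩, fun h' => ⟨?_, h'.2⟩⟩
      rcases Nat.lt_succ_iff_lt_or_eq.1 h'.1 with h'' | rfl
      · exact h''
      · exact absurd (hiff.2 h'.2) h
    · simp [memTest, BoolExpr.cost, NatExpr.cost]
  · intro τ _ h j hj
    rw [h j]
    exact or_congr_right (and_iff_right hj)
  · simp only [NatExpr.cost]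
    omega

/-- Mark the squares along the path that ends in the node in the natural variable `19`. -/
def tracePath (L : ℕ) : Program :=
  forLoop 20 (.add (.var 1) (.const 1)) (.seq (decode L 19 3 15)
    (.seq markMembers (.setNat 19 (.get 5 (.var 19)))))

theorem tracePath_spec {L m s Y : ℕ} {σ : State} {prev : ℕ → ℕ} (hm : σ.natVar 1 = m)
    (hmY : m + 1 ≤ Y) (hprev : σ.natArr 5 = prev) (hs : σ.natVar 19 = s)
    (hlt : ∀ i ≤ m, prev^[i] s < Y) (h0 : ∀ j < m, σ.natArr 0 j = 0) :
    Within (tracePath L) (Y * (Y * ((L + 1) * 150))) σ fun τ =>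
      ∀ j < m, (τ.natArr 0 j = 1 ↔ ∃ i < m + 1, j ∈ nodeSet m L (prev^[i] s)) := by
  refine Within.time_mono (Within.imp (Within.forLoop (b := m + 1) (Y := Y)
    (T := Y * ((L + 1) * 90) + (Y * 30 + 3))
    (fun i τ => τ.natVar 19 = prev^[i] s ∧
      ∀ j < m, (τ.natArr 0 j = 1 ↔ ∃ i' < i, j ∈ nodeSet m L (prev^[i'] s)))
    rfl hmY (by omega) ?_ ?_ ?_) le_rfl ?_) ?_
  · intro τ hF
    have : τ.natVar 1 = m := (hF.natVar 1 rfl).trans hm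
    simp [NatExpr.eval, this]
  · refine ⟨by simpa using hs, fun j hj => ?_⟩
    simp [h0 j hj]
  · rintro i τ hi hF h20 ⟨h19, hI⟩
    have hτ1 : τ.natVar 1 = m := (hF.natVar 1 rfl).trans hm
    refine Within.seq ((decode_spec (by omega) hτ1 h19 (hlt i (by omega)) (by omega)).imp le_rfl ?_)
    rintro υ hF' ⟨hrep, -⟩
    refine Within.seq ((markMembers_spec ((hF'.natVar 1 rfl).trans hτ1) hrep (by omega)
      (by omega)).imp le_rfl ?_)
    intro χ hF'' hχ
    have e5 : χ.natArr 5 = prev :=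
      (((hF''.natArr 5 rfl).trans (hF'.natArr 5 rfl)).trans (hF.natArr 5 rfl)).trans hprev
    have e19 : χ.natVar 19 = prev^[i] s :=
      ((hF''.natVar 19 rfl).trans (hF'.natVar 19 rfl)).trans h19
    -- After layer `0` the entry of `prev` has no meaning, but then the loop has ended and it is
    -- never decoded.
    refine Within.setNat (e := .get 5 (.var 19)) ⟨?_, fun j hj => ?_⟩
    · simp [NatExpr.eval, e5, e19, Function.iterate_succ_apply']
    · rw [State.setNat_natArr, State.setNat_natArr, hχ j hj, hF'.natArr 0 rfl, hI j hj]
      constructor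
      · rintro (⟨i', hi', h⟩ | h)
        · exact ⟨i', by omega, h⟩
        · exact ⟨i, by omega, h⟩
      · rintro ⟨i', hi', h⟩
        rcases Nat.lt_succ_iff_lt_or_eq.1 hi' with hi' | rfl
        · exact Or.inl ⟨i', hi', h⟩
        · exact Or.inr h
  · intro τ _ h
    exact h.2
  · have h1 : 1 ≤ Y * (L + 1) := Nat.mul_pos (by omega) (by omega)
    have h2 : Y ≤ Y * (L + 1) := Nat.le_mul_of_pos_right _ (by omega)
    refine Nat.mul_le_mul_left _ ?_
    simp only [NatExpr.cost]
    nlinarith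

end Main


/-! ### The complete program: optimality and running time -/

section Solver

/-- The complete program. -/
def solver (K L : ℕ) : Program :=
  .seq (computeOffsets K) (.seq (computeCuts K) (.seq (computePower L) (.seq (fillTables L)
    (.seq (findBest L) (.cond (.natLe (.const 1) (.var 18))
      (.seq (.setNat 2 (.const 1)) (tracePath L)) .skip)))))

/-- `S` is a set of squares, given by their indices, that covers all points. -/
def IsIndexCover (n m : ℕ) (X : ℕ → ℕ → ℝ) (S : Finset ℕ) : Prop :=
  S ⊆ Finset.range m ∧ ∀ q < n, 1 ≤ depth (Covers X) S q

/-- The squares selected by a state. -/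
def selectedIndices (m : ℕ) (τ : State) : Finset ℕ :=
  (Finset.range m).filter fun j => τ.natArr 0 j = 1

theorem solver_spec {K L n m : ℕ} {X : ℕ → ℕ → ℝ} {σ : State} (hσ : HasInput n m X σ)
    (h2 : σ.natVar 2 = 0) (h0 : ∀ j < m, σ.natArr 0 j = 0)
    (hL : 8 * (2 * K + 2) ^ 2 ≤ L)
    (hx : ∀ q < n, |X 0 q - X 0 0| ≤ K) (hy : ∀ q < n, |X 1 q - X 1 0| ≤ K) :
    Within (solver K L) (((K + L + 1) * 1500) * ((n + 1) * (m + 1) ^ (3 * (L + 1)))) σ fun τ =>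
      ((∃ S, IsIndexCover n m X S) → τ.natVar 2 = 1 ∧ IsIndexCover n m X (selectedIndices m τ) ∧
        ∀ S, IsIndexCover n m X S → uniqueDepthCount (Covers X) n S ≤
          uniqueDepthCount (Covers X) n (selectedIndices m τ)) ∧
      ((¬ ∃ S, IsIndexCover n m X S) → τ.natVar 2 = 0) := by
  set Y := (m + 1) ^ (L + 1) with hYdef
  have hmY : m + 1 ≤ Y := Nat.le_self_pow (by omega) _
  have hY : 1 ≤ Y := by omega
  refine Within.time_mono (Within.seq (U := (n + 1) * (Y * ((K + 1) * 170)) +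
    (Y * ((L + 1) * 60) + (Y * (Y * ((n + 1) * (Y * (L + 1)) * 750)) +
      (Y * (Y * ((L + 1) * 150)) + (10 + Y * (Y * ((L + 1) * 150)))))))
    ((computeOffsets_spec hσ (by omega) hY).imp le_rfl ?_)) ?_
  · intro σ₁ hF₁ hoff
    have hσ₁ : HasInput n m X σ₁ := hσ.frame ⟨⟨rfl, rfl⟩, ⟨rfl, rfl⟩, rfl, rfl⟩ hF₁
    refine Within.seq ((computeCuts_spec hσ₁ hoff (by omega) hY).imp le_rfl ?_)
    intro σ₂ hF₂ hcut
    have hσ₂ : HasInput n m X σ₂ := hσ₁.frame ⟨⟨rfl, rfl⟩, ⟨rfl, rfl⟩, rfl, rfl⟩ hF₂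
    refine Within.seq ((computePower_spec hσ₂.m_eq hmY).imp le_rfl ?_)
    intro σ₃ hF₃ hN
    have hσ₃ : HasInput n m X σ₃ := hσ₂.frame ⟨⟨rfl, rfl⟩, ⟨rfl, rfl⟩, rfl, rfl⟩ hF₃
    refine Within.seq ((fillTables_spec hσ₃
      (fun q hq => by rw [hF₃.natArr 1 rfl]; exact hcut q hq) hN hmY).imp le_rfl ?_)
    intro σ₄ hF₄ htable
    have hσ₄ : HasInput n m X σ₄ := hσ₃.frame ⟨⟨rfl, rfl⟩, ⟨rfl, rfl⟩, rfl, rfl⟩ hF₄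
    refine Within.seq ((findBest_spec hσ₄.m_eq ((hF₄.natVar 3 rfl).trans hN) hmY rfl).imp le_rfl ?_)
    rintro σ₅ hF₅ ⟨hatt, hmax⟩
    have hcutle : ∀ q < (sweepNetwork K L n m X).n,
        (sweepNetwork K L n m X).cut q ≤ (sweepNetwork K L n m X).m :=
      fun q _ => cutIndex_le K X m q
    -- Every cover is represented by a path, so the maximum found exceeds its objective by at least
    -- one; in particular the maximum is positive if a cover exists.
    have hge : ∀ S, IsIndexCover n m X S →
        uniqueDepthCount (Covers X) n S + 1 ≤ σ₅.natVar 18 := by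
      rintro S ⟨hSm, hS⟩
      obtain ⟨s, hs, hl, hle⟩ := exists_best_ge_of_cover hL hx hy htable hSm hS
      exact hle.trans (hmax s hs hl)
    have e2 : σ₅.natVar 2 = 0 :=
      ((((hF₅.natVar 2 rfl).trans (hF₄.natVar 2 rfl)).trans (hF₃.natVar 2 rfl)).trans
        (hF₂.natVar 2 rfl)).trans ((hF₁.natVar 2 rfl).trans h2)
    have e0 : σ₅.natArr 0 = σ.natArr 0 :=
      ((((hF₅.natArr 0 rfl).trans (hF₄.natArr 0 rfl)).trans (hF₃.natArr 0 rfl)).trans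
        (hF₂.natArr 0 rfl)).trans (hF₁.natArr 0 rfl)
    have e5 : σ₅.natArr 5 = σ₄.natArr 5 := hF₅.natArr 5 rfl
    refine Within.time_mono (Within.cond (fun hb => Within.seq (Within.setNat
      (Within.imp (tracePath_spec (s := σ₅.natVar 19) (prev := σ₄.natArr 5) (m := m) (Y := Y)
        ?_ hmY ?_ ?_ ?_ ?_) le_rfl ?_))) fun hb => Within.skip ?_) ?_
    · simpa using (hF₅.natVar 1 rfl).trans hσ₄.m_eq
    · simpa using e5
    · simp
    · have hne : σ₅.natVar 18 ≠ 0 := Nat.one_le_iff_ne_zero.1 hb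
      obtain ⟨h1, h3, h4⟩ := hatt hne
      exact Network.iterate_prev_lt htable h1 h3 (by rw [h4]; exact hne)
    · intro j hj
      simpa [e0] using h0 j hj
    · intro τ hF hτ
      have hne : σ₅.natVar 18 ≠ 0 := Nat.one_le_iff_ne_zero.1 hb
      obtain ⟨h1, h3, h4⟩ := hatt hne
      obtain ⟨hcov, hval⟩ := Network.traceSet_spec hcutle htable h1 h3 (by rw [h4]; exact hne)
      have hsel : selectedIndices m τ =
          (sweepNetwork K L n m X).traceSet (σ₄.natArr 5) (σ₅.natVar 19) := by
        ext j
        simp only [selectedIndices, Network.traceSet, Finset.mem_filter, Finset.mem_range,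
          Finset.mem_biUnion, sweepNetwork]
        constructor
        · rintro ⟨hj, h⟩
          exact (hτ j hj).1 h
        · rintro ⟨i, hi, h⟩
          have hj := Finset.mem_range.1 (nodeSet_subset _ _ _ h)
          exact ⟨hj, (hτ j hj).2 ⟨i, hi, h⟩⟩
      have hicov : IsIndexCover n m X (selectedIndices m τ) :=
        ⟨Finset.filter_subset _ _, hsel ▸ hcov⟩
      refine ⟨fun _ => ⟨?_, hicov, fun S hS => ?_⟩, fun hn => absurd ⟨_, hicov⟩ hn⟩
      · simpa [NatExpr.eval] using hF.natVar 2 rfl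
      · have := hge S hS
        rw [← h4, hval, ← hsel] at this
        exact Nat.le_of_succ_le_succ this
    -- A zero maximum rules out covers, and the answer variable still holds its initial value, which
    -- means no.
    · have hz : σ₅.natVar 18 = 0 := by
        simpa [BoolExpr.Holds, NatExpr.eval] using hb
      refine ⟨fun ⟨S, hS⟩ => ?_, fun _ => e2⟩
      have := hge S hS
      omega
    · simp [BoolExpr.cost, NatExpr.cost]
      omega
  · have hpow : (m + 1) ^ (3 * (L + 1)) = Y * (Y * Y) := by
      rw [hYdef, ← pow_add, ← pow_add]
      congr 1
      ring
    rw [hpow]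
    clear_value Y
    set M := (n + 1) * (Y * (Y * Y)) with hM
    have hYY : 1 ≤ Y * Y := Nat.mul_pos hY hY
    have hA : Y * Y ≤ Y * (Y * Y) := Nat.le_mul_of_pos_left _ hY
    have hB : Y * (Y * Y) ≤ M := Nat.le_mul_of_pos_left _ (by omega)
    have hC : Y ≤ Y * Y := Nat.le_mul_of_pos_left _ hY
    have hD : (n + 1) * Y ≤ M := Nat.mul_le_mul_left _ (hC.trans hA)
    have i1 : Y * (K + 1) ≤ M * (K + 1) := Nat.mul_le_mul_right _ (by omega)
    have i2 : (n + 1) * Y * (K + 1) ≤ M * (K + 1) := Nat.mul_le_mul_right _ hD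
    have i3 : Y * (L + 1) ≤ M * (L + 1) := Nat.mul_le_mul_right _ (by omega)
    have i4 : Y * Y * (L + 1) ≤ M * (L + 1) := Nat.mul_le_mul_right _ (by omega)
    have e1 : Y * (Y * ((n + 1) * (Y * (L + 1)) * 750)) = M * (L + 1) * 750 := by rw [hM]; ring
    rw [e1]
    nlinarith

end Solver

/-! ### Instances as sets of points and squares -/

section Instances

variable {n m : ℕ} (p : Fin n → ℝ × ℝ) (d : Fin m → ℝ × ℝ)

theorem hasInput_inputState : HasInput n m (inputState p d).realArr (inputState p d) :=
  ⟨by simp [inputState], by simp [inputState], rfl, rfl, rfl, rfl⟩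

theorem covers_inputState (j : Fin m) (q : Fin n) :
    Covers (inputState p d).realArr j q ↔ p q ∈ unitSquare (d j) := by
  have harr : ∀ {l : ℕ} (f : Fin l → ℝ) (i : Fin l), toArray f i = f i := fun f i => by
    simp [toArray]
  simp [Covers, inputState, unitSquare, Set.mem_Icc, Prod.le_def, harr]
  tauto

/-- The set of lower-left corners of the squares with indices in `J`. -/
noncomputable def corners (J : Finset ℕ) : Finset (ℝ × ℝ) :=
  (Finset.univ.filter fun j : Fin m => (j : ℕ) ∈ J).image d

theorem exists_corners_eq {S : Finset (ℝ × ℝ)} (hS : S ⊆ Finset.univ.image d) :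
    ∃ J ⊆ Finset.range m, corners d J = S := by
  classical
  refine ⟨(Finset.univ.filter fun j : Fin m => d j ∈ S).map Fin.valEmbedding, ?_, ?_⟩
  · intro j hj
    obtain ⟨i, -, rfl⟩ := Finset.mem_map.1 hj
    simp
  · ext c
    simp only [corners, Finset.mem_image, Finset.mem_filter, Finset.mem_univ, true_and,
      Finset.mem_map, Fin.valEmbedding_apply]
    constructor
    · rintro ⟨j, ⟨i, hi, hij⟩, rfl⟩
      rwa [← Fin.ext hij]
    · intro hc
      obtain ⟨j, -, rfl⟩ := Finset.mem_image.1 (hS hc)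
      exact ⟨j, ⟨j, hc, rfl⟩, rfl⟩

theorem corners_selectedIndices (τ : State) : corners d (selectedIndices m τ) = τ.selected d := by
  unfold corners State.selected selectedIndices
  congr 1
  ext j
  simp

variable {d}

open Classical in
-- As the squares are distinct, counting indices is counting squares; this carries feasibility and
-- objective over to sets of corners.
theorem depth_eq_card (hd : Function.Injective d) {J : Finset ℕ} (hJ : J ⊆ Finset.range m)
    (q : Fin n) : depth (Covers (inputState p d).realArr) J q =
      ((corners d J).filter fun c => p q ∈ unitSquare c).card := by
  have hJ' : (J.filter fun j => Covers (inputState p d).realArr j q) =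
      (Finset.univ.filter fun j : Fin m => (j : ℕ) ∈ J ∧ p q ∈ unitSquare (d j)).map
        Fin.valEmbedding := by
    ext j
    simp only [Finset.mem_filter, Finset.mem_map, Finset.mem_univ, true_and,
      Fin.valEmbedding_apply]
    constructor
    · rintro ⟨hj, hc⟩
      exact ⟨⟨j, Finset.mem_range.1 (hJ hj)⟩, ⟨hj, (covers_inputState p d _ q).1 hc⟩, rfl⟩
    · rintro ⟨i, ⟨hi, hc⟩, rfl⟩
      exact ⟨hi, (covers_inputState p d i q).2 hc⟩
  rw [depth, hJ', Finset.card_map, corners, Finset.filter_image, Finset.card_image_of_injective _ hd,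
    Finset.filter_filter]

theorem isCover_corners_iff (hd : Function.Injective d) {J : Finset ℕ} (hJ : J ⊆ Finset.range m) :
    IsCover (Finset.univ.image p) (Finset.univ.image d) (corners d J) ↔
      IsIndexCover n m (inputState p d).realArr J := by
  classical
  have hsub : corners d J ⊆ Finset.univ.image d := Finset.image_subset_image (Finset.filter_subset _ _)
  simp only [IsCover, IsIndexCover, hsub, hJ, true_and, Finset.mem_image, Finset.mem_univ,
    forall_exists_index, forall_apply_eq_imp_iff]
  have key : ∀ q : Fin n, (∃ c ∈ corners d J, p q ∈ unitSquare c) ↔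
      1 ≤ depth (Covers (inputState p d).realArr) J q := by
    intro q
    rw [depth_eq_card p hd hJ, Nat.one_le_iff_ne_zero, Finset.card_ne_zero,
      Finset.filter_nonempty_iff]
  exact ⟨fun h q hq => (key ⟨q, hq⟩).1 (h ⟨q, hq⟩), fun h q => (key q).2 (h q q.2)⟩

variable {p}

theorem uniqueCount_corners (hp : Function.Injective p) (hd : Function.Injective d) {J : Finset ℕ}
    (hJ : J ⊆ Finset.range m) : uniqueCount (Finset.univ.image p) (corners d J) =
      uniqueDepthCount (Covers (inputState p d).realArr) n J := by
  classical
  have key : ∀ q : Fin n, (∃! c, c ∈ corners d J ∧ p q ∈ unitSquare c) ↔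
      depth (Covers (inputState p d).realArr) J q = 1 := by
    intro q
    rw [depth_eq_card p hd hJ, Finset.card_eq_one]
    simp only [Finset.eq_singleton_iff_unique_mem, Finset.mem_filter]
    exact ⟨fun ⟨c, h1, h2⟩ => ⟨c, h1, h2⟩, fun ⟨c, h1, h2⟩ => ⟨c, h1, h2⟩⟩
  have hmap : (Finset.range n).filter
      (fun q => depth (Covers (inputState p d).realArr) J q = 1) =
      (Finset.univ.filter fun q : Fin n =>
        depth (Covers (inputState p d).realArr) J q = 1).map Fin.valEmbedding := by
    ext q
    simp only [Finset.mem_filter, Finset.mem_range, Finset.mem_map, Finset.mem_univ, true_and,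
      Fin.valEmbedding_apply]
    constructor
    · rintro ⟨hq, h⟩
      exact ⟨⟨q, hq⟩, h, rfl⟩
    · rintro ⟨i, h, rfl⟩
      exact ⟨i.2, h⟩
  rw [uniqueCount, Finset.filter_image, Finset.card_image_of_injective _ hp, uniqueDepthCount, hmap,
    Finset.card_map]
  congr 1
  ext q
  simp [key]

end Instances

/-! ### The running time in the required form, and the theorem -/

/-- Both `n + 1` and `m + 1` are at most twice the respective maximum with one; the resulting powers
of two go into the constant that depends on `k`. -/
theorem time_bound {n m c e : ℕ} {E : ℝ} (he : (e : ℝ) ≤ E) :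
    ((c * ((n + 1) * (m + 1) ^ e) : ℕ) : ℝ) ≤
      (c * 2 * 2 ^ e : ℝ) * (max n 1 : ℕ) * ((max m 1 : ℕ) : ℝ) ^ E := by
  have h1 : (1 : ℝ) ≤ ((max m 1 : ℕ) : ℝ) := by exact_mod_cast le_max_right m 1
  have h2 : ((max m 1 : ℕ) : ℝ) ^ e ≤ ((max m 1 : ℕ) : ℝ) ^ E := by
    rw [← Real.rpow_natCast]
    exact Real.rpow_le_rpow_of_exponent_le h1 he
  have h3 : c * ((n + 1) * (m + 1) ^ e) ≤ c * ((2 * max n 1) * (2 * max m 1) ^ e) := by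
    gcongr <;> omega
  calc ((c * ((n + 1) * (m + 1) ^ e) : ℕ) : ℝ)
      ≤ ((c * ((2 * max n 1) * (2 * max m 1) ^ e) : ℕ) : ℝ) := by exact_mod_cast h3
    _ = (c * 2 * 2 ^ e : ℝ) * (max n 1 : ℕ) * ((max m 1 : ℕ) : ℝ) ^ e := by
      rw [Nat.cast_mul, Nat.cast_mul, Nat.cast_pow, Nat.cast_mul, Nat.cast_mul, mul_pow]
      push_cast
      ring
    _ ≤ _ := by gcongr

end UniqueSquareCover

open UniqueSquareCover in
theorem theorem3 :
    ∃ C : ℝ, ∀ k : ℝ, 1 ≤ k → ∃ (prog : Program) (A : ℝ),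
      ∀ (n m : ℕ) (p : Fin n → ℝ × ℝ) (d : Fin m → ℝ × ℝ),
        Function.Injective p → Function.Injective d →
        (∃ z : ℝ × ℝ, ∀ i, p i ∈ Set.Icc z (z + (k, k))) →
        ∃ (τ : State) (t : ℕ),
          Runs prog (inputState p d) τ t ∧
          (t : ℝ) ≤ A * (max n 1 : ℕ) * ((max m 1 : ℕ) : ℝ) ^ (C * k ^ 2) ∧
          ((∃ S, IsCover (Finset.univ.image p) (Finset.univ.image d) S) →
            τ.saysYes ∧
            IsOptimal (Finset.univ.image p) (Finset.univ.image d) (τ.selected d)) ∧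
          ((¬ ∃ S, IsCover (Finset.univ.image p) (Finset.univ.image d) S) → τ.saysNo) := by
  -- Since `2 * K + 2 ≤ 6 * k`, the exponent `3 * (L + 1)` is at most `3 * (288 * k ^ 2 + 1)`, which
  -- is at most `867 * k ^ 2`.
  refine ⟨867, fun k hk => ?_⟩
  set K := ⌈k⌉₊ with hK
  set L := 8 * (2 * K + 2) ^ 2 with hL
  refine ⟨solver K L, (((K + L + 1) * 1500 : ℕ) : ℝ) * 2 * 2 ^ (3 * (L + 1)),
    fun n m p d hp hd ⟨z, hz⟩ => ?_⟩
  have hkK : k ≤ K := Nat.le_ceil k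
  have hpos : ∀ q < n, |(inputState p d).realArr 0 q - (inputState p d).realArr 0 0| ≤ K ∧
      |(inputState p d).realArr 1 q - (inputState p d).realArr 1 0| ≤ K := by
    intro q hq
    have h1 := hz ⟨q, hq⟩
    -- The reference point `0` exists because some index `q < n` is given; without points there is
    -- nothing to show.
    have h2 := hz ⟨0, by omega⟩
    simp only [Set.mem_Icc, Prod.le_def, Prod.fst_add, Prod.snd_add] at h1 h2
    have hn : 0 < n := by omega
    simp only [inputState, toArray, hq, hn, dif_pos, if_true, one_ne_zero, if_false, abs_le]
    refine ⟨⟨?_, ?_⟩, ?_, ?_⟩ <;> linarith [h1.1.1, h1.1.2, h1.2.1, h1.2.2, h2.1.1, h2.1.2, h2.2.1,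
      h2.2.2]
  obtain ⟨τ, t, hrun, ht, hyes, hno⟩ := solver_spec (K := K) (L := L) (hasInput_inputState p d)
    (by simp [inputState]) (fun _ _ => rfl) le_rfl (fun q hq => (hpos q hq).1)
    fun q hq => (hpos q hq).2
  have hex : (∃ S, IsCover (Finset.univ.image p) (Finset.univ.image d) S) ↔
      ∃ J, IsIndexCover n m (inputState p d).realArr J := by
    constructor
    · rintro ⟨S, hS⟩
      obtain ⟨J, hJ, rfl⟩ := exists_corners_eq d hS.1
      exact ⟨J, (isCover_corners_iff p hd hJ).1 hS⟩
    · rintro ⟨J, hJ⟩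
      exact ⟨_, (isCover_corners_iff p hd hJ.1).2 hJ⟩
  have hexp : ((3 * (L + 1) : ℕ) : ℝ) ≤ 867 * k ^ 2 := by
    have hKk : (K : ℝ) < k + 1 := Nat.ceil_lt_add_one (by linarith)
    have h1 : (2 * K + 2 : ℝ) ≤ 6 * k := by linarith
    have h2 : (2 * K + 2 : ℝ) ^ 2 ≤ (6 * k) ^ 2 := by gcongr
    have h3 : (1 : ℝ) ≤ k ^ 2 := one_le_pow₀ hk
    rw [hL, Nat.cast_mul, Nat.cast_add, Nat.cast_mul, Nat.cast_pow]
    push_cast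
    linarith [mul_pow 6 k 2]
  refine ⟨τ, t, hrun, ?_, fun h => ?_, fun h => hno (mt hex.2 h)⟩
  · exact (Nat.cast_le.2 ht).trans (time_bound hexp)
  · obtain ⟨h2, hcov, hmax⟩ := hyes (hex.1 h)
    refine ⟨h2, ?_, fun S hS => ?_⟩
    · rw [← corners_selectedIndices]
      exact (isCover_corners_iff p hd hcov.1).2 hcov
    · obtain ⟨J, hJ, rfl⟩ := exists_corners_eq d hS.1
      rw [← corners_selectedIndices, uniqueCount_corners hp hd hJ,
        uniqueCount_corners hp hd hcov.1]
      exact hmax J ((isCover_corners_iff p hd hJ).1 hS)
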